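/- **Coercivity of the vorticity-stabilized (SUPG-curl) form.** Let $\Omega\subset\mathbb R^2$ be a bounded open (polygonal) domain with a conforming decomposition $\Omega_h$ into triangles $E$ (whose interiors lie in $\Omega$ and whose union is $\overline\Omega$), let $h_E$ be the diameter of $E$, and assume (M1): every $E$ is star shaped with respect to a ball of radius $\rho_E$ with $h_E\le c_{\rm M1}\rho_E$. Fix a unit normal $\boldsymbol n^e$ on every edge $e$, and let $[\![\boldsymbol w]\!]_e(\boldsymbol x)=\lim_{s\to0^+}\big(\boldsymbol w(\boldsymbol x-s\boldsymbol n^e)-\boldsymbol w(\boldsymbol x+s\boldsymbol n^e)\big)$ if $e\not\subset\partial\Omega$ and $[\![\boldsymbol w]\!]_e=0$ if $e\subset\partial\Omega$. Let $\tau>0$, $N\in\mathbb N$, $t_n=n\tau$ ($0\le n\le N+1$), $I_n=(t_n,t_{n+1})$; for $\boldsymbol v$ piecewise continuous in time let $\boldsymbol v^n_\pm$ be the one-sided limits at $t_n$ and $[\![\boldsymbol v]\!]_{t_n}=\boldsymbol v^n_+-\boldsymbol v^n_-$. Let $k\in\mathbb N$, and let $\boldsymbol{\mathcal V}_h\subset[H^1_0(\Omega)]^2$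 and $\mathcal Q_h\subset L^2_0(\Omega)$ be linear spaces such that every $\boldsymbol v\in\boldsymbol{\mathcal V}_h$ is on each $E$ a polynomial of degree at most $k+3$, and $\mathrm{div}\,\boldsymbol{\mathcal V}_h=\mathcal Q_h$. Let $\boldsymbol{\mathcal Z}_h=\{\boldsymbol v\in\boldsymbol{\mathcal V}_h:\int_\Omega q\,\mathrm{div}\,\boldsymbol v=0\ \ \forall q\in\mathcal Q_h\}$, and let $\boldsymbol{\mathcal Z}_h^\tau$ be the set of functions of time that on each $I_n$, $n=0,\dots,N$, are affine in $t$ with coefficients in $\boldsymbol{\mathcal Z}_h$. Let $\nu>0$ and $\delta_E\ge0$ ($E\in\Omega_h$). With $\mathrm{curl}\,\boldsymbol v=\partial_1v_2-\partial_2v_1$, $\boldsymbol\epsilon$ the symmetric gradient, $\mathbf{div}$ the row-wise divergence, $((\boldsymbol\nabla\boldsymbol u)\boldsymbol w)_i=\sum_jw_j\partial_ju_i$, and $(\cdot,\cdot)$, $\|\cdot\|$ the inner product and norm of $L^2(\Omega)$, put (derivatives inside the elements) $$\begin{aligned}\mathcal K_{\rm stab}(\boldsymbol w_1,\boldsymbol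 w_2;\boldsymbol u,\boldsymbol v)={}&\nu\int_\Omega\boldsymbol\epsilon(\boldsymbol u):\boldsymbol\epsilon(\boldsymbol v)+\int_\Omega[(\boldsymbol\nabla\boldsymbol u)\boldsymbol w_1]\cdot\boldsymbol v\\&+\sum_E\delta_E\int_E\mathrm{curl}\big(\boldsymbol u_t+(\boldsymbol\nabla\boldsymbol u)\boldsymbol w_1-\nu\,\mathbf{div}\,\boldsymbol\epsilon(\boldsymbol u)\big)\,\mathrm{curl}\big(\boldsymbol v_t+(\boldsymbol\nabla\boldsymbol v)\boldsymbol w_2\big)\\&+\sum_E\frac{h_E^2}{2}\int_{\partial E}[\![(\boldsymbol\nabla\boldsymbol u)\boldsymbol w_1]\!]\cdot[\![(\boldsymbol\nabla\boldsymbol v)\boldsymbol w_2]\!]\,\mathrm de,\end{aligned}$$ $$\mathcal A_{{\rm stab},n}(\boldsymbol w_1,\boldsymbol w_2;\boldsymbol v,\boldsymbol z)=\int_0^{t_{n+1}}(\boldsymbol v_t,\boldsymbol z)\,\mathrm dt+\sum_{j=1}^n([\![\boldsymbol v]\!]_{t_j},\boldsymbol z^j_+)+(\boldsymbol v^0_+,\boldsymbol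 z^0_+)+\int_0^{t_{n+1}}\mathcal K_{\rm stab}(\boldsymbol w_1,\boldsymbol w_2;\boldsymbol v,\boldsymbol z)\,\mathrm dt,$$ $$\begin{aligned}\|\boldsymbol v\|^2_{\boldsymbol W,n}={}&\tfrac12\Big(\|\boldsymbol v^{n+1}_-\|^2+\sum_{j=1}^n\|[\![\boldsymbol v]\!]_{t_j}\|^2+\|\boldsymbol v^0_+\|^2\Big)+\nu\|\boldsymbol\epsilon(\boldsymbol v)\|^2_{L^2(0,t_{n+1};L^2(\Omega))}\\&+\sum_E\delta_E\|\mathrm{curl}(\boldsymbol v_t+(\boldsymbol\nabla\boldsymbol v)\boldsymbol W)\|^2_{L^2(0,t_{n+1};L^2(E))}+\sum_E\frac{h_E^2}2\|[\![(\boldsymbol\nabla\boldsymbol v)\boldsymbol W]\!]\|^2_{L^2(0,t_{n+1};L^2(\partial E))}.\end{aligned}$$ Let $\gamma_E$ be the smallest positive constant such that $\|p\|_{H^2(E)}\le\gamma_Eh_E^{-2}\|p\|_{L^2(E)}$ for all polynomials $p$ of degree at most $k+2$, where $\|p\|^2_{H^2(E)}=\sum_{|\alpha|\le2}\|D^\alpha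 p\|^2_{L^2(E)}$ (sum over multi-indices). If $\delta_E\le h_E^4/(\nu\gamma_E^2)$ for all $E\in\Omega_h$, then for all $\boldsymbol W,\boldsymbol V\in\boldsymbol{\mathcal Z}_h^\tau$ $$\mathcal A_{{\rm stab},n}(\boldsymbol W,\boldsymbol W;\boldsymbol V,\boldsymbol V)\ \ge\ \tfrac12\,\|\boldsymbol V\|^2_{\boldsymbol W,n}\qquad n=0,1,\dots,N.$$ -/

import Mathlib

open MeasureTheory Filter Topology Set

noncomputable section

namespace VorticitySUPG

/-- The Euclidean plane. -/
abbrev Plane := EuclideanSpace ℝ (Fin 2)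

/-- The coordinate unit vector `e_j`. -/
def unitVec (j : Fin 2) : Plane := EuclideanSpace.single j 1

/-! ### Differential operators (pointwise, used inside the open mesh elements) -/

/-- `∂_j f` for a scalar function. -/
def pd (j : Fin 2) (f : Plane → ℝ) (x : Plane) : ℝ := fderiv ℝ f x (unitVec j)

/-- The divergence of a vector field. -/
def divg (v : Plane → Plane) (x : Plane) : ℝ := ∑ i, pd i (fun y => v y i) x

/-- The scalar curl `∂v₂/∂x₁ - ∂v₁/∂x₂`. -/
def rot (v : Plane → Plane) (x : Plane) : ℝ :=
  pd 0 (fun y => v y 1) x - pd 1 (fun y => v y 0) x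

/-- The symmetric gradient `ε(v)`. -/
def symGrad (v : Plane → Plane) (x : Plane) : Matrix (Fin 2) (Fin 2) ℝ :=
  Matrix.of fun i j => (1 / 2) * (pd j (fun y => v y i) x + pd i (fun y => v y j) x)

/-- The row-wise divergence of a tensor field. -/
def divTensor (A : Plane → Matrix (Fin 2) (Fin 2) ℝ) (x : Plane) : Plane :=
  WithLp.toLp 2 fun i => ∑ j, pd j (fun y => A y i j) x

/-- The product `A : B`. -/
def ddot (A B : Matrix (Fin 2) (Fin 2) ℝ) : ℝ := ∑ i, ∑ j, A i j * B i j

/-- `(∇u) w`, whose `i`-th component is `∑ j, w_j ∂_j u_i`. -/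
def convect (u w : Plane → Plane) (x : Plane) : Plane := fderiv ℝ u x (w x)

/-! ### The space `[H¹₀(Ω)]²` -/

/-- `v ∈ [H¹₀(Ω)]²`: `v` is the limit, in the `H¹(Ω)`-norm, of smooth vector fields with compact
support in `Ω` (the limit `G` of the gradients is then the weak gradient of `v`). -/
def MemH10 (Ω : Set Plane) (v : Plane → Plane) : Prop :=
  MemLp v 2 (volume.restrict Ω) ∧
  ∃ G : Plane → (Plane →L[ℝ] Plane), MemLp G 2 (volume.restrict Ω) ∧
    ∃ φ : ℕ → Plane → Plane,
      (∀ m, ContDiff ℝ (⊤ : ℕ∞) (φ m) ∧ HasCompactSupport (φ m) ∧ tsupport (φ m) ⊆ Ω) ∧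
      Tendsto (fun m => eLpNorm (fun x => φ m x - v x) 2 (volume.restrict Ω)) atTop (𝓝 0) ∧
      Tendsto (fun m => eLpNorm (fun x => fderiv ℝ (φ m) x - G x) 2 (volume.restrict Ω))
        atTop (𝓝 0)

/-! ### Triangulations -/

/-- The closed triangle (or edge) with the given vertices. -/
def hull (s : Finset Plane) : Set Plane := convexHull ℝ (s : Set Plane)

/-- The open triangle with the given vertices. -/
def openTri (s : Finset Plane) : Set Plane := interior (hull s)

/-- The diameter `h_E`. -/
def hE (s : Finset Plane) : ℝ := Metric.diam (hull s)

/-- The edges of a triangle, as pairs of vertices. -/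
def edges (s : Finset Plane) : Finset (Finset Plane) := s.powersetCard 2

/-- A conforming decomposition of `Ω` into (nondegenerate) triangles, each given by its set of
vertices, with a fixed unit normal on every edge. -/
structure Triangulation (Ω : Set Plane) where
  elems : Finset (Finset Plane)
  card_eq : ∀ s ∈ elems, s.card = 3
  indep : ∀ s ∈ elems, AffineIndependent ℝ ((↑) : s → Plane)
  interior_subset : ∀ s ∈ elems, openTri s ⊆ Ω
  cover : ⋃ s ∈ elems, hull s = closure Ω
  conforming : ∀ s ∈ elems, ∀ r ∈ elems,
    hull s ∩ hull r = convexHull ℝ ((s : Set Plane) ∩ (r : Set Plane))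
  normal : Finset Plane → Plane
  normal_unit : ∀ s ∈ elems, ∀ e ∈ edges s, ‖normal e‖ = 1
  normal_orth : ∀ s ∈ elems, ∀ e ∈ edges s, ∀ p ∈ e, ∀ q ∈ e, inner ℝ (normal e) (q - p) = 0

/-- Shape regularity with constant `c`: each element is star shaped with respect to a ball of
radius `ρ` with `h_E ≤ c ρ`. -/
def Triangulation.ShapeRegular {Ω : Set Plane} (𝒯 : Triangulation Ω) (c : ℝ) : Prop :=
  ∀ s ∈ 𝒯.elems, ∃ (y : Plane) (ρ : ℝ), 0 < ρ ∧ Metric.ball y ρ ⊆ hull s ∧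
    (∀ z ∈ Metric.ball y ρ, StarConvex ℝ z (hull s)) ∧ hE s ≤ c * ρ

open Classical in
/-- The jump of a piecewise continuous vector field at a point of the edge `e`; it is zero on
boundary edges. -/
def Triangulation.jump {Ω : Set Plane} (𝒯 : Triangulation Ω) (e : Finset Plane)
    (w : Plane → Plane) (x : Plane) : Plane :=
  if hull e ⊆ frontier Ω then 0
  else limUnder (𝓝[>] (0 : ℝ)) fun s => w (x - s • 𝒯.normal e) - w (x + s • 𝒯.normal e)

/-- `∫_{∂E} ⟦f⟧ · ⟦g⟧ de` (arc length is the one-dimensional Hausdorff measure). -/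
def Triangulation.jumpIntegral {Ω : Set Plane} (𝒯 : Triangulation Ω) (s : Finset Plane)
    (f g : Plane → Plane) : ℝ :=
  ∑ e ∈ edges s, ∫ x in hull e, inner ℝ (𝒯.jump e f x) (𝒯.jump e g x)
    ∂(Measure.hausdorffMeasure 1 : Measure Plane)

/-! ### Polynomials and the constant of the inverse estimate -/

/-- The value of a polynomial in two variables at a point of the plane. -/
def evalAt (p : MvPolynomial (Fin 2) ℝ) (x : Plane) : ℝ := MvPolynomial.eval (fun j => x j) p

/-- The restriction of `v` to the open set `S` is in `[ℙ_d(S)]²`. -/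
def IsPolyOn (d : ℕ) (S : Set Plane) (v : Plane → Plane) : Prop :=
  ∀ i, ∃ p : MvPolynomial (Fin 2) ℝ, p.totalDegree ≤ d ∧ ∀ x ∈ S, v x i = evalAt p x

/-- `‖p‖²_{L²(S)}` for a polynomial. -/
def polyL2Sq (S : Set Plane) (p : MvPolynomial (Fin 2) ℝ) : ℝ := ∫ x in S, (evalAt p x) ^ 2

/-- `‖p‖_{W^m_2(S)}`: the square root of the sum of `‖D^α p‖²_{L²(S)}` over the multi-indices
`α = (α₁, α₂)` with `α₁ + α₂ ≤ m`. -/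
def polySobolevNorm (m : ℕ) (S : Set Plane) (p : MvPolynomial (Fin 2) ℝ) : ℝ :=
  Real.sqrt (∑ α ∈ (Finset.range (m + 1) ×ˢ Finset.range (m + 1)).filter
      (fun α => α.1 + α.2 ≤ m),
    polyL2Sq S ((MvPolynomial.pderiv 0)^[α.1] ((MvPolynomial.pderiv 1)^[α.2] p)))

/-- `γ_E(d, m, 2)`: the smallest positive constant with
`‖p‖_{W^m_2(E)} ≤ γ h_E^{-m} ‖p‖_{L²(E)}` for all `p ∈ ℙ_d(E)`. -/
def inverseConst (d m : ℕ) (s : Finset Plane) : ℝ :=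
  sInf {γ : ℝ | 0 < γ ∧ ∀ p : MvPolynomial (Fin 2) ℝ, p.totalDegree ≤ d →
    polySobolevNorm m (openTri s) p ≤ γ / hE s ^ m * Real.sqrt (polyL2Sq (openTri s) p)}

/-! ### The finite element spaces -/

/-- The form `b(v, q)`. -/
def formB (Ω : Set Plane) (v : Plane → Plane) (q : Plane → ℝ) : ℝ := ∫ x in Ω, q x * divg v x

/-- A conforming pair: `𝒱_h ⊂ [H¹₀(Ω)]²` consists of piecewise polynomials of degree at most
`k + 3`, `𝒬_h ⊂ L²₀(Ω)`, and `𝒬_h` is the range of the divergence on `𝒱_h`. Functions are given by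
representatives which are polynomial in each open element, so that derivatives inside the elements
are classical. -/
structure FESpaces (Ω : Set Plane) (𝒯 : Triangulation Ω) (k : ℕ) where
  V : Submodule ℝ (Plane → Plane)
  Q : Submodule ℝ (Plane → ℝ)
  V_H10 : ∀ v ∈ V, MemH10 Ω v
  V_poly : ∀ v ∈ V, ∀ s ∈ 𝒯.elems, IsPolyOn (k + 3) (openTri s) v
  Q_L20 : ∀ q ∈ Q, MemLp q 2 (volume.restrict Ω) ∧ ∫ x in Ω, q x = 0
  div_mem : ∀ v ∈ V, ∃ q ∈ Q, divg v =ᵐ[volume.restrict Ω] q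
  div_surj : ∀ q ∈ Q, ∃ v ∈ V, divg v =ᵐ[volume.restrict Ω] q

/-- The discrete kernel `𝒵_h = {v ∈ 𝒱_h : b(v, q) = 0 for all q ∈ 𝒬_h}`. -/
def FESpaces.Z {Ω : Set Plane} {𝒯 : Triangulation Ω} {k : ℕ} (X : FESpaces Ω 𝒯 k) :
    Set (Plane → Plane) :=
  {v | v ∈ X.V ∧ ∀ q ∈ X.Q, formB Ω v q = 0}

/-! ### Time discretization, `t_n = n τ` -/

/-- `ℙ₁(I^τ, Z)`: on each interval `I_n = (t_n, t_{n+1})`, `n = 0, …, N`, the function is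
affine in time with coefficients in `Z`. -/
def P1Time (τ : ℝ) (N : ℕ) (Z : Set (Plane → Plane)) : Set (ℝ → Plane → Plane) :=
  {v | ∀ n ≤ N, ∃ a ∈ Z, ∃ b ∈ Z, ∀ t ∈ Ioo (n * τ) ((n + 1) * τ), v t = a + t • b}

/-- The time derivative `v_t`. -/
def dt (v : ℝ → Plane → Plane) (t : ℝ) (x : Plane) : Plane := deriv (fun s => v s x) t

/-- `v_+^n`. -/
def tracePlus (τ : ℝ) (v : ℝ → Plane → Plane) (n : ℕ) (x : Plane) : Plane :=
  limUnder (𝓝[>] (n * τ)) fun t => v t x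

/-- `v_-^n`. -/
def traceMinus (τ : ℝ) (v : ℝ → Plane → Plane) (n : ℕ) (x : Plane) : Plane :=
  limUnder (𝓝[<] (n * τ)) fun t => v t x

/-- The time jump `⟦v⟧_{t_n} = v_+^n - v_-^n`. -/
def timeJump (τ : ℝ) (v : ℝ → Plane → Plane) (n : ℕ) (x : Plane) : Plane :=
  tracePlus τ v n x - traceMinus τ v n x

/-! ### Forms -/

/-- The inner product of `[L²(Ω)]²`. -/
def l2 (Ω : Set Plane) (u v : Plane → Plane) : ℝ := ∫ x in Ω, inner ℝ (u x) (v x)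

/-- `a(u, v) = ∫_Ω ε(u) : ε(v)`. -/
def formA (Ω : Set Plane) (u v : Plane → Plane) : ℝ := ∫ x in Ω, ddot (symGrad u x) (symGrad v x)

/-- `c(w; u, v) = ∫_Ω [(∇u) w] · v`. -/
def formC (Ω : Set Plane) (w u v : Plane → Plane) : ℝ :=
  ∫ x in Ω, inner ℝ (convect u w x) (v x)

/-- `u_t + (∇u) w` at time `t`. -/
def material (w u : ℝ → Plane → Plane) (t : ℝ) (x : Plane) : Plane :=
  dt u t x + convect (u t) (w t) x

section Stabilization

variable {Ω : Set Plane} (𝒯 : Triangulation Ω) (δ : Finset Plane → ℝ) (ν : ℝ)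

/-- The form `𝒞(w₁, w₂; u, v)` at time `t`. -/
def stabC (w₁ w₂ u v : ℝ → Plane → Plane) (t : ℝ) : ℝ :=
  ∑ s ∈ 𝒯.elems, δ s * ∫ x in openTri s, rot (material w₁ u t) x * rot (material w₂ v t) x

/-- The form `ℒ(w₂; u, v)` at time `t`. -/
def stabL (w₂ u v : ℝ → Plane → Plane) (t : ℝ) : ℝ :=
  ∑ s ∈ 𝒯.elems, δ s * ∫ x in openTri s,
    rot (fun y => -(ν • divTensor (symGrad (u t)) y)) x * rot (material w₂ v t) x

/-- The form `𝒥(w₁, w₂; u, v)` at time `t`. -/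
def stabJ (w₁ w₂ u v : ℝ → Plane → Plane) (t : ℝ) : ℝ :=
  ∑ s ∈ 𝒯.elems, hE s ^ 2 / 2 *
    𝒯.jumpIntegral s (convect (u t) (w₁ t)) (convect (v t) (w₂ t))

/-- The form `𝒦_stab(w₁, w₂; u, v)` at time `t`. -/
def kStab (w₁ w₂ u v : ℝ → Plane → Plane) (t : ℝ) : ℝ :=
  ν * formA Ω (u t) (v t) + formC Ω (w₁ t) (u t) (v t) + stabC 𝒯 δ w₁ w₂ u v t
    + stabL 𝒯 δ ν w₂ u v t + stabJ 𝒯 w₁ w₂ u v t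

/-- The form `𝒜_{stab,n}(w₁, w₂; v, z)`. -/
def aStab (τ : ℝ) (n : ℕ) (w₁ w₂ v z : ℝ → Plane → Plane) : ℝ :=
  (∫ t in (0 : ℝ)..((n + 1) * τ), l2 Ω (dt v t) (z t))
    + ∑ j ∈ Finset.Icc 1 n, l2 Ω (timeJump τ v j) (tracePlus τ z j)
    + l2 Ω (tracePlus τ v 0) (tracePlus τ z 0)
    + ∫ t in (0 : ℝ)..((n + 1) * τ), kStab 𝒯 δ ν w₁ w₂ v z t

/-- The squared norm `‖v‖²_{W,n}`. -/
def normSqW (τ : ℝ) (n : ℕ) (W v : ℝ → Plane → Plane) : ℝ :=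
  (1 / 2) * ((∫ x in Ω, ‖traceMinus τ v (n + 1) x‖ ^ 2)
      + ∑ j ∈ Finset.Icc 1 n, (∫ x in Ω, ‖timeJump τ v j x‖ ^ 2)
      + ∫ x in Ω, ‖tracePlus τ v 0 x‖ ^ 2)
    + ν * (∫ t in (0 : ℝ)..((n + 1) * τ), ∫ x in Ω,
        ddot (symGrad (v t) x) (symGrad (v t) x))
    + ∑ s ∈ 𝒯.elems, δ s * (∫ t in (0 : ℝ)..((n + 1) * τ), ∫ x in openTri s,
        (rot (material W v t) x) ^ 2)
    + ∑ s ∈ 𝒯.elems, hE s ^ 2 / 2 * (∫ t in (0 : ℝ)..((n + 1) * τ), ∑ e ∈ edges s,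
        ∫ x in hull e, ‖𝒯.jump e (convect (v t) (W t)) x‖ ^ 2
          ∂(Measure.hausdorffMeasure 1 : Measure Plane))

end Stabilization

end VorticitySUPG

end

open VorticitySUPG

namespace VorticitySUPG

noncomputable section

/-! ### Geometry of the mesh -/

/-! Test the form with `V` itself. On each time slab `∫ (V_t, V)` is half a difference of squared
norms, and at each node `(V₊ - V₋, V₊)` splits by polarization. Together they telescope to exactly
the time part of the norm (`time_energy`). At a fixed time the convective term vanishes, because `W`
is divergence-free and the fields lie in `H¹₀` (`KernelField.formC_eq_zero`). The viscous, curl and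
jump terms are squares, so only the viscous part of the residual, `stabL`, can be negative.

That term is controlled by `curl div ε(v) = ½ Δ curl v` (`rot_divTensor_symGrad`). On an element
`curl v` is a polynomial of degree at most `k + 2`, so Young's inequality, the inverse estimate and
the bound on `δ` show that the term costs at most half of the curl square plus `ν/4 ‖curl v‖²`
(`element_stab_bound`). For divergence-free fields in `H¹₀`, `‖curl v‖² = 2 ‖ε(v)‖²`
(`KernelField.integral_rot_sq`), so the second loss is half of the viscous term. Half of everything
survives (`kStab_lower_bound`).

Two analytic points take up most of the proof. The global identities avoid boundary terms on
elements: they hold for test functions and pass to the limit in one factor at a time (`H10Approx`),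
the other factors being bounded. Splitting and comparing integrals in time requires integrability,
which comes from smooth extensions in space-time on each slab and element (`SmoothST`, `ContPiece`).
For the jumps, which are defined as limits, this requires an element on each side of every interior
edge (`exists_elem_other_side`). -/

theorem isCompact_hull (s : Finset Plane) : IsCompact (hull s) :=
  s.finite_toSet.isCompact_convexHull ℝ

theorem isOpen_openTri (s : Finset Plane) : IsOpen (openTri s) := isOpen_interior

theorem openTri_subset_hull (s : Finset Plane) : openTri s ⊆ hull s := interior_subset

theorem volume_hull_diff_openTri (s : Finset Plane) : volume (hull s \ openTri s) = 0 := by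
  have h := (convex_convexHull ℝ (s : Set Plane)).addHaar_frontier volume
  change volume (closure (hull s) \ openTri s) = 0 at h
  rwa [IsClosed.closure_eq (isCompact_hull s).isClosed] at h

variable {Ω : Set Plane}

/-- By conformity the two hulls meet in the hull of their common vertices. Distinct triangles share
at most two, and the hull of two points has empty interior in the plane. -/
theorem openTri_disjoint (𝒯 : Triangulation Ω) {s r : Finset Plane} (hs : s ∈ 𝒯.elems)
    (hr : r ∈ 𝒯.elems) (hne : s ≠ r) : Disjoint (openTri s) (openTri r) := by
  classical
  rw [Set.disjoint_iff_inter_eq_empty, openTri, openTri, ← interior_inter, 𝒯.conforming s hs r hr,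
    ← Finset.coe_inter]
  by_contra hemp
  have hspan := interior_convexHull_nonempty_iff_affineSpan_eq_top.1
    (Set.nonempty_iff_ne_empty.2 hemp)
  have hlt : (s ∩ r).card < 3 := by
    rw [← 𝒯.card_eq s hs]
    refine Finset.card_lt_card ⟨Finset.inter_subset_left, fun h => hne ?_⟩
    refine Finset.eq_of_subset_of_card_le (fun x hx => (Finset.mem_inter.1 (h hx)).2) ?_
    rw [𝒯.card_eq s hs, 𝒯.card_eq r hr]
  have h1 : Module.finrank ℝ (vectorSpan ℝ ((s ∩ r : Finset Plane) : Set Plane)) = 2 := by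
    rw [← direction_affineSpan, hspan, AffineSubspace.direction_top, finrank_top,
      finrank_euclideanSpace_fin]
  have hne' : (s ∩ r).Nonempty := by
    rw [Finset.nonempty_iff_ne_empty]
    intro h
    rw [h, Finset.coe_empty, vectorSpan_empty, finrank_bot] at h1
    omega
  have h2 := finrank_vectorSpan_image_finset_le ℝ (id : Plane → Plane) (s ∩ r) (n := (s ∩ r).card - 1)
    (by have := hne'.card_pos; omega)
  rw [Finset.image_id, h1] at h2
  omega

theorem subset_iUnion_hull (𝒯 : Triangulation Ω) {x : Plane} (hx : x ∈ Ω) :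
    ∃ s ∈ 𝒯.elems, x ∈ hull s := by
  have := subset_closure hx
  rw [← 𝒯.cover] at this
  simpa using this

theorem isBounded_of_triangulation (𝒯 : Triangulation Ω) : Bornology.IsBounded Ω := by
  refine Bornology.IsBounded.subset ?_ subset_closure
  rw [← 𝒯.cover]
  exact (Bornology.isBounded_biUnion_finset _).2 fun s _ => (isCompact_hull s).isBounded

theorem isFiniteMeasure_restrict (𝒯 : Triangulation Ω) :
    IsFiniteMeasure (volume.restrict Ω : Measure Plane) :=
  ⟨by simpa using (isBounded_of_triangulation 𝒯).measure_lt_top⟩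

theorem iUnion_openTri_subset (𝒯 : Triangulation Ω) : ⋃ s ∈ 𝒯.elems, openTri s ⊆ Ω :=
  iUnion₂_subset 𝒯.interior_subset

/-- The missing points lie on boundaries of elements, and the boundary of a convex set is Lebesgue
null. -/
theorem iUnion_openTri_ae_eq (𝒯 : Triangulation Ω) :
    (⋃ s ∈ 𝒯.elems, openTri s : Set Plane) =ᵐ[volume] Ω := by
  refine Filter.EventuallyLE.antisymm (iUnion_openTri_subset 𝒯).eventuallyLE ?_
  rw [ae_le_set]
  refine measure_mono_null (t := ⋃ s ∈ 𝒯.elems, (hull s \ openTri s)) ?_ ?_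
  · rintro x ⟨hx, hx'⟩
    obtain ⟨s, hs, hxs⟩ := subset_iUnion_hull 𝒯 hx
    simp only [mem_iUnion, not_exists] at hx' ⊢
    exact ⟨s, hs, hxs, hx' s hs⟩
  · exact (measure_biUnion_null_iff 𝒯.elems.countable_toSet).2 fun s _ => volume_hull_diff_openTri s

theorem restrict_eq_iUnion_openTri (𝒯 : Triangulation Ω) :
    (volume.restrict Ω : Measure Plane) = volume.restrict (⋃ s ∈ 𝒯.elems, openTri s) :=
  (Measure.restrict_congr_set (iUnion_openTri_ae_eq 𝒯)).symm

theorem ae_restrict_of_openTri (𝒯 : Triangulation Ω) {p : Plane → Prop}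
    (h : ∀ s ∈ 𝒯.elems, ∀ᵐ x ∂volume.restrict (openTri s), p x) : ∀ᵐ x ∂volume.restrict Ω, p x := by
  rw [restrict_eq_iUnion_openTri 𝒯]
  exact (ae_restrict_biUnion_finset_iff _ _ _).2 h

theorem ae_mem_openTri (𝒯 : Triangulation Ω) :
    ∀ᵐ x ∂volume.restrict Ω, ∃ s ∈ 𝒯.elems, x ∈ openTri s :=
  ae_restrict_of_openTri 𝒯 fun s hs => by
    filter_upwards [ae_restrict_mem (isOpen_openTri s).measurableSet] with x hx using ⟨s, hs, hx⟩

/-! ### Piecewise continuous functions -/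

/-- `f` coincides on every open element with a function continuous on the whole plane. -/
def PwCont {E : Type*} [TopologicalSpace E] (𝒯 : Triangulation Ω) (f : Plane → E) : Prop :=
  ∀ s ∈ 𝒯.elems, ∃ F : Plane → E, Continuous F ∧ ∀ x ∈ openTri s, f x = F x

theorem memLp_top_openTri {E : Type*} [NormedAddCommGroup E] {s : Finset Plane} {f F : Plane → E}
    (hF : Continuous F) (h : ∀ x ∈ openTri s, f x = F x) :
    MemLp f ⊤ (volume.restrict (openTri s)) := by
  obtain ⟨C, hC⟩ := (isCompact_hull s).exists_bound_of_continuousOn hF.continuousOn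
  have hfF : F =ᵐ[volume.restrict (openTri s)] f := by
    filter_upwards [ae_restrict_mem (isOpen_openTri s).measurableSet] with x hx using (h x hx).symm
  refine MemLp.ae_eq hfF (memLp_top_of_bound hF.aestronglyMeasurable C ?_)
  filter_upwards [ae_restrict_mem (isOpen_openTri s).measurableSet] with x hx
  exact hC x (openTri_subset_hull s hx)

theorem PwCont.memLp_top {E : Type*} [NormedAddCommGroup E] {𝒯 : Triangulation Ω} {f : Plane → E}
    (h : PwCont 𝒯 f) : MemLp f ⊤ (volume.restrict Ω) := by
  classical
  -- Since the elements are disjoint and cover almost everything, `f` is almost everywhere the sum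
  -- of its restrictions to them.
  have hsum : MemLp (fun x => ∑ s ∈ 𝒯.elems, (openTri s).indicator f x) ⊤ (volume.restrict Ω) := by
    refine memLp_finsetSum _ fun s hs => ?_
    rw [memLp_indicator_iff_restrict (isOpen_openTri s).measurableSet,
      Measure.restrict_restrict (isOpen_openTri s).measurableSet,
      inter_eq_left.2 (𝒯.interior_subset s hs)]
    obtain ⟨F, hF, hfF⟩ := h s hs
    exact memLp_top_openTri hF hfF
  refine hsum.ae_eq ?_
  filter_upwards [ae_mem_openTri 𝒯] with x ⟨s, hs, hxs⟩
  rw [Finset.sum_eq_single s, indicator_of_mem hxs]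
  · intro r hr hrs
    exact indicator_of_notMem (fun hxr => (openTri_disjoint 𝒯 hr hs hrs).le_bot ⟨hxr, hxs⟩) _
  · exact fun h => absurd hs h

theorem PwCont.integrable {E : Type*} [NormedAddCommGroup E] {𝒯 : Triangulation Ω} {f : Plane → E}
    (h : PwCont 𝒯 f) : Integrable f (volume.restrict Ω) := by
  have := isFiniteMeasure_restrict 𝒯
  exact h.memLp_top.integrable le_top

theorem integral_eq_sum_openTri {𝒯 : Triangulation Ω} {f : Plane → ℝ} (h : PwCont 𝒯 f) :
    ∫ x in Ω, f x = ∑ s ∈ 𝒯.elems, ∫ x in openTri s, f x := by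
  rw [restrict_eq_iUnion_openTri 𝒯, integral_biUnion_finset]
  · exact fun s _ => (isOpen_openTri s).measurableSet
  · exact fun s hs r hr hne => openTri_disjoint 𝒯 hs hr hne
  · exact fun s hs => IntegrableOn.mono_set h.integrable (𝒯.interior_subset s hs)

theorem PwCont.comp₂ {E F G : Type*} [TopologicalSpace E] [TopologicalSpace F] [TopologicalSpace G]
    {𝒯 : Triangulation Ω} {f : Plane → E} {g : Plane → F} (hf : PwCont 𝒯 f) (hg : PwCont 𝒯 g)
    {φ : E → F → G} (hφ : Continuous (Function.uncurry φ)) : PwCont 𝒯 fun x => φ (f x) (g x) := by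
  intro s hs
  obtain ⟨F, hF, hfF⟩ := hf s hs
  obtain ⟨G, hG, hgG⟩ := hg s hs
  exact ⟨fun x => φ (F x) (G x), hφ.comp (hF.prodMk hG), fun x hx => by simp only [hfF x hx, hgG x hx]⟩

theorem PwCont.add {𝒯 : Triangulation Ω} {f g : Plane → ℝ} (hf : PwCont 𝒯 f) (hg : PwCont 𝒯 g) :
    PwCont 𝒯 fun x => f x + g x := hf.comp₂ hg (φ := fun a b => a + b) (by fun_prop)

theorem PwCont.sub {𝒯 : Triangulation Ω} {f g : Plane → ℝ} (hf : PwCont 𝒯 f) (hg : PwCont 𝒯 g) :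
    PwCont 𝒯 fun x => f x - g x := hf.comp₂ hg (φ := fun a b => a - b) (by fun_prop)

theorem PwCont.mul {𝒯 : Triangulation Ω} {f g : Plane → ℝ} (hf : PwCont 𝒯 f) (hg : PwCont 𝒯 g) :
    PwCont 𝒯 fun x => f x * g x := hf.comp₂ hg (φ := fun a b => a * b) (by fun_prop)

/-! ### Smooth dependence on time and space -/

/-- On `I × S`, the function `f` is the restriction of a smooth function on `ℝ × Plane`. -/
def SmoothST {E : Type*} [NormedAddCommGroup E] [NormedSpace ℝ E] (I : Set ℝ) (S : Set Plane)
    (f : ℝ → Plane → E) : Prop :=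
  ∃ F : ℝ × Plane → E, ContDiff ℝ (⊤ : ℕ∞) F ∧ ∀ t ∈ I, ∀ x ∈ S, f t x = F (t, x)

section SmoothST

variable {E F G : Type*} [NormedAddCommGroup E] [NormedSpace ℝ E] [NormedAddCommGroup F]
  [NormedSpace ℝ F] [NormedAddCommGroup G] [NormedSpace ℝ G] {I : Set ℝ} {S : Set Plane}

theorem SmoothST.comp {f : ℝ → Plane → E} (hf : SmoothST I S f) {φ : E → F}
    (hφ : ContDiff ℝ (⊤ : ℕ∞) φ) : SmoothST I S fun t x => φ (f t x) := by
  obtain ⟨f', hf', hff'⟩ := hf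
  exact ⟨fun z => φ (f' z), hφ.comp hf', fun t ht x hx => by simp only [hff' t ht x hx]⟩

theorem SmoothST.comp₂ {f : ℝ → Plane → E} {g : ℝ → Plane → F} (hf : SmoothST I S f)
    (hg : SmoothST I S g) {φ : E → F → G} (hφ : ContDiff ℝ (⊤ : ℕ∞) (Function.uncurry φ)) :
    SmoothST I S fun t x => φ (f t x) (g t x) := by
  obtain ⟨f', hf', hff'⟩ := hf
  obtain ⟨g', hg', hgg'⟩ := hg
  exact ⟨fun z => φ (f' z) (g' z), hφ.comp (hf'.prodMk hg'),
    fun t ht x hx => by simp only [hff' t ht x hx, hgg' t ht x hx]⟩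

theorem SmoothST.add {f g : ℝ → Plane → E} (hf : SmoothST I S f) (hg : SmoothST I S g) :
    SmoothST I S fun t x => f t x + g t x :=
  hf.comp₂ hg (φ := fun a b => a + b) (contDiff_fst.add contDiff_snd)

theorem SmoothST.sub {f g : ℝ → Plane → E} (hf : SmoothST I S f) (hg : SmoothST I S g) :
    SmoothST I S fun t x => f t x - g t x :=
  hf.comp₂ hg (φ := fun a b => a - b) (contDiff_fst.sub contDiff_snd)

theorem SmoothST.mul {f g : ℝ → Plane → ℝ} (hf : SmoothST I S f) (hg : SmoothST I S g) :
    SmoothST I S fun t x => f t x * g t x :=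
  hf.comp₂ hg (φ := fun a b => a * b) (contDiff_fst.mul contDiff_snd)

theorem SmoothST.apply {f : ℝ → Plane → Plane} (hf : SmoothST I S f) (i : Fin 2) :
    SmoothST I S fun t x => f t x i :=
  hf.comp (φ := fun a : Plane => a i) (by fun_prop)

/-- On an open `S` the spatial derivative depends only on the germ, so it is the restriction to the
space directions of the total derivative of the extension. -/
theorem SmoothST.fderiv (hS : IsOpen S) {f : ℝ → Plane → E} (hf : SmoothST I S f) :
    SmoothST I S fun t x => fderiv ℝ (f t) x := by
  obtain ⟨f', hf', hff'⟩ := hf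
  refine ⟨fun z => (_root_.fderiv ℝ f' z).comp (ContinuousLinearMap.inr ℝ ℝ Plane),
    (hf'.fderiv_right (m := ((⊤ : ℕ∞) : WithTop ℕ∞)) (by exact_mod_cast le_rfl)).clm_comp
      contDiff_const, fun t ht x hx => ?_⟩
  have h1 : f t =ᶠ[𝓝 x] fun y => f' (t, y) := by
    filter_upwards [hS.mem_nhds hx] with y hy using hff' t ht y hy
  change _root_.fderiv ℝ (f t) x = _
  rw [h1.fderiv_eq]
  have h2 : HasFDerivAt f' (_root_.fderiv ℝ f' (t, x)) (t, x) :=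
    (hf'.differentiable (by simp)).differentiableAt.hasFDerivAt
  exact (h2.comp x (hasFDerivAt_prodMk_right t x)).fderiv

theorem SmoothST.pd (hS : IsOpen S) {f : ℝ → Plane → ℝ} (hf : SmoothST I S f) (j : Fin 2) :
    SmoothST I S fun t x => pd j (f t) x :=
  (hf.fderiv hS).comp (φ := fun a : Plane →L[ℝ] ℝ => a (unitVec j)) (by fun_prop)

theorem SmoothST.convect (hS : IsOpen S) {u w : ℝ → Plane → Plane} (hu : SmoothST I S u)
    (hw : SmoothST I S w) : SmoothST I S fun t x => convect (u t) (w t) x :=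
  (hu.fderiv hS).comp₂ hw (φ := fun a b => a b) (contDiff_fst.clm_apply contDiff_snd)

theorem SmoothST.rot (hS : IsOpen S) {u : ℝ → Plane → Plane} (hu : SmoothST I S u) :
    SmoothST I S fun t x => rot (u t) x :=
  ((hu.apply 1).pd hS 0).sub ((hu.apply 0).pd hS 1)

theorem SmoothST.symGrad (hS : IsOpen S) {u : ℝ → Plane → Plane} (hu : SmoothST I S u)
    (i j : Fin 2) : SmoothST I S fun t x => symGrad (u t) x i j :=
  (((hu.apply i).pd hS j).add ((hu.apply j).pd hS i)).comp (φ := fun a => (1 / 2) * a)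
    (by fun_prop)

theorem SmoothST.ddot_symGrad (hS : IsOpen S) {u : ℝ → Plane → Plane} (hu : SmoothST I S u) :
    SmoothST I S fun t x => ddot (VorticitySUPG.symGrad (u t) x) (VorticitySUPG.symGrad (u t) x) := by
  simp only [ddot, Fin.sum_univ_two]
  have h := fun i j => (hu.symGrad hS i j).mul (hu.symGrad hS i j)
  exact ((h 0 0).add (h 0 1)).add ((h 1 0).add (h 1 1))

theorem SmoothST.divTensor (hS : IsOpen S) {u : ℝ → Plane → Plane} (hu : SmoothST I S u) :
    SmoothST I S fun t x => divTensor (VorticitySUPG.symGrad (u t)) x := by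
  have h := fun i j => (hu.symGrad hS i j).pd hS j
  have h2 := fun i => (h i 0).add (h i 1)
  have := (h2 0).comp₂ (h2 1) (φ := fun a b => (WithLp.toLp 2 ![a, b] : Plane)) (by
    rw [contDiff_euclidean]
    intro i
    fin_cases i
    · exact contDiff_fst
    · exact contDiff_snd)
  convert this using 3 with t x
  ext i
  fin_cases i <;> simp [VorticitySUPG.divTensor, Fin.sum_univ_two]

theorem SmoothST.congr {f g : ℝ → Plane → E} (hf : SmoothST I S f)
    (h : ∀ t ∈ I, ∀ x ∈ S, g t x = f t x) : SmoothST I S g := by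
  obtain ⟨f', hf', hff'⟩ := hf
  exact ⟨f', hf', fun t ht x hx => by rw [h t ht x hx, hff' t ht x hx]⟩

theorem SmoothST.exists_continuous {f : ℝ → Plane → E} (hf : SmoothST I S f) {t : ℝ} (ht : t ∈ I) :
    ∃ F : Plane → E, Continuous F ∧ ∀ x ∈ S, f t x = F x := by
  obtain ⟨f', hf', hff'⟩ := hf
  exact ⟨fun x => f' (t, x), hf'.continuous.comp (by fun_prop), hff' t ht⟩

end SmoothST

/-! ### Continuity in time of spatial integrals -/

/-- `g` coincides on `I` with a continuous function on the line. -/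
def ContPiece (I : Set ℝ) (g : ℝ → ℝ) : Prop := ∃ G : ℝ → ℝ, Continuous G ∧ ∀ t ∈ I, g t = G t

theorem ContPiece.add {I : Set ℝ} {f g : ℝ → ℝ} (hf : ContPiece I f) (hg : ContPiece I g) :
    ContPiece I fun t => f t + g t := by
  obtain ⟨F, hF, hfF⟩ := hf
  obtain ⟨G, hG, hgG⟩ := hg
  exact ⟨fun t => F t + G t, hF.add hG, fun t ht => by simp only [hfF t ht, hgG t ht]⟩

theorem ContPiece.const_mul {I : Set ℝ} {f : ℝ → ℝ} (hf : ContPiece I f) (c : ℝ) :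
    ContPiece I fun t => c * f t := by
  obtain ⟨F, hF, hfF⟩ := hf
  exact ⟨fun t => c * F t, continuous_const.mul hF, fun t ht => by simp only [hfF t ht]⟩

theorem ContPiece.sum {ι : Type*} {I : Set ℝ} (A : Finset ι) {f : ι → ℝ → ℝ}
    (hf : ∀ i ∈ A, ContPiece I (f i)) : ContPiece I fun t => ∑ i ∈ A, f i t := by
  classical
  induction A using Finset.induction_on with
  | empty => exact ⟨fun _ => 0, continuous_const, fun t _ => by simp⟩
  | insert a A ha ih =>
    simp only [Finset.sum_insert ha]
    exact (hf a (by simp)).add (ih fun i hi => hf i (by simp [hi]))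

theorem ContPiece.congr {I : Set ℝ} {f g : ℝ → ℝ} (hf : ContPiece I f) (h : ∀ t ∈ I, g t = f t) :
    ContPiece I g := by
  obtain ⟨F, hF, hfF⟩ := hf
  exact ⟨F, hF, fun t ht => by rw [h t ht, hfF t ht]⟩

/-- The interval is open because discrete functions are unconstrained at the time nodes, which form
a null set. -/
theorem ContPiece.intervalIntegrable {a b : ℝ} (hab : a ≤ b) {f : ℝ → ℝ}
    (hf : ContPiece (Ioo a b) f) : IntervalIntegrable f volume a b := by
  obtain ⟨F, hF, hfF⟩ := hf
  rw [intervalIntegrable_iff_integrableOn_Ioo_of_le hab]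
  refine IntegrableOn.congr_fun (f := F) ?_ (fun t ht => (hfF t ht).symm) measurableSet_Ioo
  exact (intervalIntegrable_iff_integrableOn_Ioo_of_le hab).1 (hF.intervalIntegrable a b)

theorem SmoothST.contPiece_integral {I : Set ℝ} {s : Finset Plane} {f : ℝ → Plane → ℝ}
    (hf : SmoothST I (openTri s) f) : ContPiece I fun t => ∫ x in openTri s, f t x := by
  obtain ⟨F, hF, hfF⟩ := hf
  -- Continuity of parametric integrals is used over a compact set: integrate over the closed
  -- triangle against the measure restricted to the open one.
  refine ⟨fun t => ∫ x in hull s, F (t, x) ∂(volume.restrict (openTri s)),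
    continuous_parametric_integral_of_continuous (f := fun t x => F (t, x)) hF.continuous
      (isCompact_hull s), fun t ht => ?_⟩
  rw [Measure.restrict_restrict (isCompact_hull s).measurableSet,
    inter_eq_right.2 (openTri_subset_hull s)]
  exact setIntegral_congr_fun (isOpen_openTri s).measurableSet fun x hx => hfF t ht x hx

theorem pwCont_of_smoothST {E : Type*} [NormedAddCommGroup E] [NormedSpace ℝ E]
    {𝒯 : Triangulation Ω} {I : Set ℝ} {f : ℝ → Plane → E}
    (hf : ∀ s ∈ 𝒯.elems, SmoothST I (openTri s) f) {t : ℝ} (ht : t ∈ I) : PwCont 𝒯 (f t) :=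
  fun s hs => (hf s hs).exists_continuous ht

theorem contPiece_integral_of_smoothST {𝒯 : Triangulation Ω} {I : Set ℝ} {f : ℝ → Plane → ℝ}
    (hf : ∀ s ∈ 𝒯.elems, SmoothST I (openTri s) f) : ContPiece I fun t => ∫ x in Ω, f t x :=
  (ContPiece.sum 𝒯.elems fun s hs => (hf s hs).contPiece_integral).congr fun _ ht =>
    integral_eq_sum_openTri (pwCont_of_smoothST hf ht)

end

noncomputable section

/-! ### Test functions and integration by parts -/

/-- `φ ∈ C_c^∞(Ω)`. -/
def IsTest (Ω : Set Plane) (φ : Plane → ℝ) : Prop :=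
  ContDiff ℝ (⊤ : ℕ∞) φ ∧ HasCompactSupport φ ∧ tsupport φ ⊆ Ω

theorem contDiff_pd {f : Plane → ℝ} (hf : ContDiff ℝ (⊤ : ℕ∞) f) (j : Fin 2) :
    ContDiff ℝ (⊤ : ℕ∞) (pd j f) :=
  (hf.fderiv_right (m := ((⊤ : ℕ∞) : WithTop ℕ∞)) (by exact_mod_cast le_rfl)).clm_apply
    contDiff_const

theorem pd_mul {f g : Plane → ℝ} {x : Plane} (hf : DifferentiableAt ℝ f x)
    (hg : DifferentiableAt ℝ g x) (j : Fin 2) :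
    pd j (fun y => f y * g y) x = pd j f x * g x + f x * pd j g x := by
  simp only [pd]
  rw [fderiv_fun_mul hf hg]
  simp only [FunLike.coe_add, FunLike.coe_smul, Pi.add_apply, Pi.smul_apply, smul_eq_mul]
  ring

theorem integral_pd_mul {f g : Plane → ℝ} (hf : ContDiff ℝ (⊤ : ℕ∞) f)
    (hg : ContDiff ℝ (⊤ : ℕ∞) g) (hc : HasCompactSupport g) (j : Fin 2) :
    ∫ x, f x * pd j g x = -∫ x, pd j f x * g x := by
  have hf' := (contDiff_pd hf j).continuous
  have hg' := (contDiff_pd hg j).continuous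
  have hcg : HasCompactSupport (pd j g) := hc.fderiv_apply (𝕜 := ℝ) (unitVec j)
  refine integral_mul_fderiv_eq_neg_fderiv_mul_of_integrable ?_ ?_ ?_
    (fun x _ => (hf.differentiable (by simp)).differentiableAt)
    (fun x _ => (hg.differentiable (by simp)).differentiableAt)
  · exact (hf'.mul hg.continuous).integrable_of_hasCompactSupport hc.mul_left
  · exact (hf.continuous.mul hg').integrable_of_hasCompactSupport hcg.mul_left
  · exact (hf.continuous.mul hg.continuous).integrable_of_hasCompactSupport hc.mul_left

variable {Ω : Set Plane}

namespace IsTest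

variable {φ ψ : Plane → ℝ}

theorem eq_zero (h : IsTest Ω φ) {x : Plane} (hx : x ∉ Ω) : φ x = 0 :=
  image_eq_zero_of_notMem_tsupport fun h' => hx (h.2.2 h')

theorem pd (h : IsTest Ω φ) (j : Fin 2) : IsTest Ω (pd j φ) :=
  ⟨contDiff_pd h.1 j, h.2.1.fderiv_apply (𝕜 := ℝ) (unitVec j),
    (tsupport_fderiv_apply_subset ℝ (unitVec j)).trans h.2.2⟩

theorem mul (h : IsTest Ω φ) (h' : IsTest Ω ψ) : IsTest Ω fun x => φ x * ψ x :=
  ⟨h.1.mul h'.1, h.2.1.mul_right, (tsupport_mul_subset_left (f := φ) (g := ψ)).trans h.2.2⟩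

theorem mono {S : Set Plane} (h : IsTest S φ) (hS : S ⊆ Ω) : IsTest Ω φ :=
  ⟨h.1, h.2.1, h.2.2.trans hS⟩

theorem memLp_top (h : IsTest Ω φ) (μ : Measure Plane) : MemLp φ ⊤ μ :=
  h.1.continuous.memLp_top_of_hasCompactSupport h.2.1 μ

theorem differentiableAt (h : IsTest Ω φ) (x : Plane) : DifferentiableAt ℝ φ x :=
  (h.1.differentiable (by simp)).differentiableAt

theorem setIntegral_mul_pd {f : Plane → ℝ} (h : IsTest Ω φ) (hf : ContDiff ℝ (⊤ : ℕ∞) f)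
    (j : Fin 2) : ∫ x in Ω, f x * VorticitySUPG.pd j φ x = -∫ x in Ω, VorticitySUPG.pd j f x * φ x := by
  rw [setIntegral_eq_integral_of_forall_compl_eq_zero,
    setIntegral_eq_integral_of_forall_compl_eq_zero, integral_pd_mul hf h.1 h.2.1]
  · exact fun x hx => by rw [h.eq_zero hx, mul_zero]
  · exact fun x hx => by rw [(h.pd j).eq_zero hx, mul_zero]

theorem setIntegral_pd (h : IsTest Ω φ) (j : Fin 2) : ∫ x in Ω, VorticitySUPG.pd j φ x = 0 := by
  have := h.setIntegral_mul_pd (f := fun _ => 1) contDiff_const j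
  simpa [VorticitySUPG.pd] using this

end IsTest

/-! ### Limits of test functions -/

/-- Hölder's inequality with exponents `1` and `∞`. -/
theorem tendsto_integral_mul_of_eLpNorm {α : Type*} {_ : MeasurableSpace α} {μ : Measure α}
    {f : ℕ → α → ℝ} {u A : α → ℝ} (hf : ∀ m, Integrable (f m) μ) (hu : Integrable u μ)
    (hA : MemLp A ⊤ μ) (h : Tendsto (fun m => eLpNorm (fun x => f m x - u x) 1 μ) atTop (𝓝 0)) :
    Tendsto (fun m => ∫ x, f m x * A x ∂μ) atTop (𝓝 (∫ x, u x * A x ∂μ)) := by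
  refine tendsto_integral_of_L1' _ (hu.mul_of_top_left hA).aestronglyMeasurable
    (Eventually.of_forall fun m => (hf m).mul_of_top_left hA) ?_
  have hle : ∀ m, eLpNorm ((fun x => f m x * A x) - fun x => u x * A x) 1 μ ≤
      eLpNorm A ⊤ μ * eLpNorm (fun x => f m x - u x) 1 μ := fun m => by
    have := eLpNorm_smul_le_eLpNorm_top_mul_eLpNorm (μ := μ) 1
      ((hf m).sub hu).aestronglyMeasurable A
    refine le_of_eq_of_le ?_ this
    congr 1
    ext x
    simp
    ring
  refine tendsto_of_tendsto_of_tendsto_of_le_of_le tendsto_const_nhds ?_ (fun _ => zero_le) hle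
  simpa using ENNReal.Tendsto.const_mul h (Or.inr hA.2.ne)

/-- `u` is bounded, and so is its gradient `g`, and `u` is a limit in the `W^{1,1}`-norm of test
functions. -/
structure H10Approx (Ω : Set Plane) (u : Plane → ℝ) (g : Fin 2 → Plane → ℝ) : Prop where
  memLp_top : MemLp u ⊤ (volume.restrict Ω)
  grad_memLp_top : ∀ j, MemLp (g j) ⊤ (volume.restrict Ω)
  approx : ∃ φ : ℕ → Plane → ℝ, (∀ m, IsTest Ω (φ m)) ∧
    Tendsto (fun m => eLpNorm (fun x => φ m x - u x) 1 (volume.restrict Ω)) atTop (𝓝 0) ∧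
    ∀ j, Tendsto (fun m => eLpNorm (fun x => pd j (φ m) x - g j x) 1 (volume.restrict Ω))
      atTop (𝓝 0)

namespace H10Approx

variable {u v w : Plane → ℝ} {g h k : Fin 2 → Plane → ℝ}

/-- A linear functional of first order that vanishes on test functions vanishes on their limits. -/
theorem integral_eq_zero [IsFiniteMeasure (volume.restrict Ω : Measure Plane)]
    (hu : H10Approx Ω u g) {A : Plane → ℝ} {B : Fin 2 → Plane → ℝ}
    (hA : MemLp A ⊤ (volume.restrict Ω)) (hB : ∀ j, MemLp (B j) ⊤ (volume.restrict Ω))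
    (h0 : ∀ φ, IsTest Ω φ → ∫ x in Ω, (φ x * A x + ∑ j, pd j φ x * B j x) = 0) :
    ∫ x in Ω, (u x * A x + ∑ j, g j x * B j x) = 0 := by
  obtain ⟨φ, hφ, hφu, hφg⟩ := hu.approx
  have key : ∀ {a : Plane → ℝ} {b : Fin 2 → Plane → ℝ}, Integrable a (volume.restrict Ω) →
      (∀ j, Integrable (b j) (volume.restrict Ω)) →
      ∫ x in Ω, (a x * A x + ∑ j, b j x * B j x) =
        (∫ x in Ω, a x * A x) + ∑ j, ∫ x in Ω, b j x * B j x := by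
    intro a b ha hb
    have h1 : Integrable (fun x => a x * A x) (volume.restrict Ω) := ha.mul_of_top_left hA
    have h2 : ∀ j, Integrable (fun x => b j x * B j x) (volume.restrict Ω) :=
      fun j => (hb j).mul_of_top_left (hB j)
    rw [integral_add h1 (integrable_finsetSum _ fun j _ => h2 j),
      integral_finsetSum _ fun j _ => h2 j]
  have i1 := fun m => ((hφ m).memLp_top (volume.restrict Ω)).integrable le_top
  have i2 := fun m j => (((hφ m).pd j).memLp_top (volume.restrict Ω)).integrable le_top
  have i3 := hu.memLp_top.integrable le_top
  have i4 := fun j => (hu.grad_memLp_top j).integrable le_top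
  rw [key i3 i4]
  have lim := (tendsto_integral_mul_of_eLpNorm i1 i3 hA hφu).add
    (tendsto_finsetSum Finset.univ fun j _ =>
      tendsto_integral_mul_of_eLpNorm (fun m => i2 m j) (i4 j) (hB j) (hφg j))
  refine tendsto_nhds_unique lim (tendsto_const_nhds.congr fun m => ?_)
  rw [← key (i1 m) (i2 m), h0 _ (hφ m)]

theorem integral_eq_zero_single [IsFiniteMeasure (volume.restrict Ω : Measure Plane)]
    (hu : H10Approx Ω u g) {A B : Plane → ℝ} (j : Fin 2)
    (hA : MemLp A ⊤ (volume.restrict Ω)) (hB : MemLp B ⊤ (volume.restrict Ω))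
    (h0 : ∀ φ, IsTest Ω φ → ∫ x in Ω, (φ x * A x + pd j φ x * B x) = 0) :
    ∫ x in Ω, (u x * A x + g j x * B x) = 0 := by
  have hB' : ∀ i : Fin 2, MemLp (fun x => if i = j then B x else 0) ⊤ (volume.restrict Ω) := by
    intro i
    by_cases hij : i = j
    · simpa [hij] using hB
    · simp [hij]
  have := hu.integral_eq_zero hA hB' (by simpa using h0)
  simpa using this

/-- This is `∫ ∂_j (u v w) = 0`. It is clear for three test functions; each factor in turn is then
replaced by its limit, as the integrand is linear in that factor and its derivative with bounded
coefficients. -/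
theorem integral_mul_mul [IsFiniteMeasure (volume.restrict Ω : Measure Plane)]
    (hu : H10Approx Ω u g) (hv : H10Approx Ω v h) (hw : H10Approx Ω w k) (j : Fin 2) :
    ∫ x in Ω, (k j x * (u x * v x) + w x * (g j x * v x + u x * h j x)) = 0 := by
  have mul : ∀ {a b : Plane → ℝ}, MemLp a ⊤ (volume.restrict Ω) → MemLp b ⊤ (volume.restrict Ω) →
      MemLp (fun x => a x * b x) ⊤ (volume.restrict Ω) := fun ha hb => hb.mul' ha
  have top := fun {φ : Plane → ℝ} (hφ : IsTest Ω φ) => hφ.memLp_top (volume.restrict Ω)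
  have s1 : ∀ φ ψ, IsTest Ω φ → IsTest Ω ψ →
      ∫ x in Ω, (w x * (pd j φ x * ψ x + φ x * pd j ψ x) + k j x * (φ x * ψ x)) = 0 := by
    intro φ ψ hφ hψ
    refine hw.integral_eq_zero_single j ((mul (top (hφ.pd j)) (top hψ)).add
      (mul (top hφ) (top (hψ.pd j)))) (mul (top hφ) (top hψ)) fun χ hχ => ?_
    rw [← (hχ.mul (hφ.mul hψ)).setIntegral_pd j]
    congr 1
    ext x
    rw [pd_mul (hχ.differentiableAt x) ((hφ.mul hψ).differentiableAt x),
      pd_mul (hφ.differentiableAt x) (hψ.differentiableAt x)]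
    ring
  have s2 : ∀ φ, IsTest Ω φ →
      ∫ x in Ω, (v x * (w x * pd j φ x + k j x * φ x) + h j x * (w x * φ x)) = 0 := by
    intro φ hφ
    refine hv.integral_eq_zero_single j ((mul hw.memLp_top (top (hφ.pd j))).add
      (mul (hw.grad_memLp_top j) (top hφ))) (mul hw.memLp_top (top hφ)) fun ψ hψ => ?_
    rw [← s1 φ ψ hφ hψ]
    congr 1
    ext x
    ring
  have s3 := hu.integral_eq_zero_single (A := fun x => h j x * w x + v x * k j x) j
    ((mul (hv.grad_memLp_top j) hw.memLp_top).add (mul hv.memLp_top (hw.grad_memLp_top j)))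
    (mul hv.memLp_top hw.memLp_top) fun φ hφ => by
      rw [← s2 φ hφ]
      congr 1
      ext x
      ring
  rw [← s3]
  congr 1
  ext x
  ring

/-- The Jacobian determinant is a null Lagrangian: for test functions, integrate by parts and use
the symmetry of second derivatives. Both factors are then replaced by their limits, one after the
other. -/
theorem integral_cross [IsFiniteMeasure (volume.restrict Ω : Measure Plane)]
    (hu : H10Approx Ω u g) (hv : H10Approx Ω v h) :
    ∫ x in Ω, (g 0 x * h 1 x - g 1 x * h 0 x) = 0 := by
  have top := fun {φ : Plane → ℝ} (hφ : IsTest Ω φ) => hφ.memLp_top (volume.restrict Ω)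
  have s1 : ∀ φ, IsTest Ω φ → ∫ x in Ω, (pd 0 φ x * h 1 x - pd 1 φ x * h 0 x) = 0 := by
    intro φ hφ
    have := hv.integral_eq_zero (A := fun _ => 0) (B := ![fun x => -pd 1 φ x, fun x => pd 0 φ x])
      MemLp.zero' (fun j => by
        fin_cases j
        · exact (top (hφ.pd 1)).neg
        · exact top (hφ.pd 0)) fun ψ hψ => by
      have e1 := (hφ.pd 1).setIntegral_mul_pd hψ.1 0
      have e2 := (hφ.pd 0).setIntegral_mul_pd hψ.1 1
      have e3 : ∀ x, pd 0 (pd 1 φ) x = pd 1 (pd 0 φ) x := by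
        intro x
        have hd : DifferentiableAt ℝ (fderiv ℝ φ) x :=
          ((hφ.1.fderiv_right (m := ((⊤ : ℕ∞) : WithTop ℕ∞)) (by exact_mod_cast le_rfl)).differentiable
            (by simp)).differentiableAt
        have hs : IsSymmSndFDerivAt ℝ φ x :=
          hφ.1.contDiffAt.isSymmSndFDerivAt (by
            simpa using WithTop.coe_le_coe.2 (le_top : (2 : ℕ∞) ≤ ⊤))
        have hp : ∀ i j, pd i (pd j φ) x = fderiv ℝ (fderiv ℝ φ) x (unitVec i) (unitVec j) := by
          intro i j
          change fderiv ℝ (fun y => fderiv ℝ φ y (unitVec j)) x (unitVec i) = _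
          rw [fderiv_clm_apply hd (differentiableAt_const _)]
          simp
        rw [hp, hp, hs.eq]
      simp only [e3] at e1
      simp only [mul_zero, zero_add, Fin.sum_univ_two, Matrix.cons_val_zero, Matrix.cons_val_one,
        mul_neg]
      rw [integral_add, integral_neg]
      · linarith
      · exact (((hψ.pd 0).mul (hφ.pd 1)).memLp_top _).integrable le_top |>.neg
      · exact (((hψ.pd 1).mul (hφ.pd 0)).memLp_top _).integrable le_top
    rw [← this]
    congr 1
    ext x
    simp [Fin.sum_univ_two]
    ring
  have := hu.integral_eq_zero (A := fun _ => 0) (B := ![h 1, fun x => -h 0 x])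
    MemLp.zero' (fun j => by
      fin_cases j
      · exact hv.grad_memLp_top 1
      · exact (hv.grad_memLp_top 0).neg) fun φ hφ => by
    refine Eq.trans ?_ (s1 φ hφ)
    congr 1
    ext x
    simp [Fin.sum_univ_two]
    ring
  rw [← this]
  congr 1
  ext x
  simp [Fin.sum_univ_two]
  ring

end H10Approx

/-! ### Piecewise smooth fields in `H¹₀` -/

/-- `v` coincides on every open element with a smooth field. -/
def PwSmooth (𝒯 : Triangulation Ω) (v : Plane → Plane) : Prop :=
  ∀ s ∈ 𝒯.elems, ∃ F : Plane → Plane, ContDiff ℝ (⊤ : ℕ∞) F ∧ ∀ x ∈ openTri s, v x = F x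

theorem PwSmooth.smoothST {𝒯 : Triangulation Ω} {v : Plane → Plane} (h : PwSmooth 𝒯 v)
    (I : Set ℝ) : ∀ s ∈ 𝒯.elems, SmoothST I (openTri s) fun _ => v := by
  intro s hs
  obtain ⟨F, hF, hvF⟩ := h s hs
  exact ⟨fun z => F z.2, hF.comp contDiff_snd, fun t _ => hvF⟩

theorem PwSmooth.pwCont_apply {𝒯 : Triangulation Ω} {v : Plane → Plane} (h : PwSmooth 𝒯 v)
    (i : Fin 2) : PwCont 𝒯 fun x => v x i :=
  pwCont_of_smoothST (fun s hs => (h.smoothST univ s hs).apply i) (mem_univ 0)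

theorem PwSmooth.pwCont_pd {𝒯 : Triangulation Ω} {v : Plane → Plane} (h : PwSmooth 𝒯 v)
    (i j : Fin 2) : PwCont 𝒯 (pd j fun y => v y i) :=
  pwCont_of_smoothST (fun s hs => ((h.smoothST univ s hs).apply i).pd (isOpen_openTri s) j)
    (mem_univ 0)

/-- Integration by parts against `ψ ∈ C_c^∞(S)` passes to the limit, so `γ` is the weak derivative
of `u` on `S`. There `u` is smooth, and the fundamental lemma of the calculus of variations
identifies `γ` with the classical derivative. -/
theorem ae_eq_pd_of_tendsto [IsFiniteMeasure (volume.restrict Ω : Measure Plane)]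
    {S : Set Plane} (hS : IsOpen S) (hSΩ : S ⊆ Ω) {φ : ℕ → Plane → ℝ} {u F γ : Plane → ℝ}
    {j : Fin 2} (hφ : ∀ m, IsTest Ω (φ m)) (hF : ContDiff ℝ (⊤ : ℕ∞) F) (huF : ∀ x ∈ S, u x = F x)
    (hu : Integrable u (volume.restrict Ω)) (hγ : Integrable γ (volume.restrict Ω))
    (h1 : Tendsto (fun m => eLpNorm (fun x => φ m x - u x) 1 (volume.restrict Ω)) atTop (𝓝 0))
    (h2 : Tendsto (fun m => eLpNorm (fun x => pd j (φ m) x - γ x) 1 (volume.restrict Ω))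
      atTop (𝓝 0)) :
    ∀ᵐ x ∂volume.restrict S, γ x = pd j u x := by
  have hloc : LocallyIntegrableOn (fun x => γ x - pd j F x) S volume :=
    (IntegrableOn.locallyIntegrableOn (IntegrableOn.mono_set hγ hSΩ)).sub
      ((contDiff_pd hF j).continuous.locallyIntegrable.locallyIntegrableOn S)
  have hz := hS.ae_eq_zero_of_integral_contDiff_smul_eq_zero hloc fun ψ hψ1 hψ2 hψ3 => by
    have hψ : IsTest S ψ := ⟨hψ1, hψ2, hψ3⟩
    have hψΩ : IsTest Ω ψ := hψ.mono hSΩ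
    have top := fun {φ : Plane → ℝ} (hφ : IsTest Ω φ) => hφ.memLp_top (volume.restrict Ω)
    have l1 := tendsto_integral_mul_of_eLpNorm (fun m => (top (hφ m)).integrable le_top) hu
      (top (hψΩ.pd j)) h1
    have l2 := tendsto_integral_mul_of_eLpNorm (fun m => (top ((hφ m).pd j)).integrable le_top) hγ
      (top hψΩ) h2
    simp only [fun m => hψΩ.setIntegral_mul_pd (hφ m).1 j] at l1
    have e1 := tendsto_nhds_unique l1 l2.neg
    have e2 : ∫ x in Ω, u x * pd j ψ x = ∫ x in Ω, F x * pd j ψ x := by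
      congr 1
      ext x
      by_cases hx : x ∈ S
      · rw [huF x hx]
      · rw [(hψ.pd j).eq_zero hx, mul_zero, mul_zero]
    rw [e2, hψΩ.setIntegral_mul_pd hF j, neg_inj] at e1
    rw [← setIntegral_eq_integral_of_forall_compl_eq_zero (s := Ω)
      (fun x hx => by rw [hψΩ.eq_zero hx, zero_smul])]
    have i1 : Integrable (fun x => γ x * ψ x) (volume.restrict Ω) :=
      hγ.mul_of_top_left (top hψΩ)
    have i2 : Integrable (fun x => pd j F x * ψ x) (volume.restrict Ω) :=
      (((contDiff_pd hF j).continuous.mul hψ.1.continuous).integrable_of_hasCompactSupport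
        hψ.2.1.mul_left).restrict
    rw [← sub_eq_zero, ← integral_sub i2 i1] at e1
    rw [← neg_eq_zero, ← integral_neg, ← e1]
    congr 1
    ext x
    simp
    ring
  rw [ae_restrict_iff' hS.measurableSet]
  filter_upwards [hz] with x hx hxS
  have he : u =ᶠ[𝓝 x] F := by
    filter_upwards [hS.mem_nhds hxS] with y hy using huF y hy
  rw [pd, he.fderiv_eq]
  exact sub_eq_zero.1 (hx hxS)

/-- Convergence in `L²` implies convergence in `L¹` because `Ω` has finite measure; boundedness
comes from piecewise smoothness. The abstract gradient `G` must agree with the elementwise classical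
one, which is checked element by element. -/
theorem MemH10.h10Approx {𝒯 : Triangulation Ω} {v : Plane → Plane} (h : MemH10 Ω v)
    (hv : PwSmooth 𝒯 v) (i : Fin 2) :
    H10Approx Ω (fun x => v x i) fun j => pd j fun y => v y i := by
  have hfin := isFiniteMeasure_restrict 𝒯
  obtain ⟨hv2, G, hG, φ, hφ, hφv, hφG⟩ := h
  have conv : ∀ {E : Type} [NormedAddCommGroup E] {f : ℕ → Plane → E} {a : ℕ → Plane → ℝ},
      (∀ m, AEStronglyMeasurable (f m) (volume.restrict Ω)) →
      Tendsto (fun m => eLpNorm (f m) 2 (volume.restrict Ω)) atTop (𝓝 0) →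
      (∀ m x, ‖a m x‖ ≤ ‖f m x‖) →
      Tendsto (fun m => eLpNorm (a m) 1 (volume.restrict Ω)) atTop (𝓝 0) := by
    intro E _ f a hm hf ha
    refine tendsto_of_tendsto_of_tendsto_of_le_of_le tendsto_const_nhds ?_ (fun _ => zero_le)
      (fun m => (eLpNorm_mono (ha m)).trans
        (eLpNorm_le_eLpNorm_mul_rpow_measure_univ (p := 1) (q := 2) (by norm_num) (hm m)))
    have hC : (volume.restrict Ω : Measure Plane) univ ^
        (1 / (1 : ENNReal).toReal - 1 / (2 : ENNReal).toReal) ≠ ⊤ :=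
      ENNReal.rpow_ne_top_of_nonneg (by norm_num) (measure_ne_top _ _)
    simpa using ENNReal.Tendsto.mul_const hf (Or.inr hC)
  have hφi : ∀ m, IsTest Ω fun x => φ m x i := fun m => by
    have hsub : tsupport (fun x => φ m x i) ⊆ tsupport (φ m) :=
      closure_mono fun x hx h0 => hx (by simp [h0])
    exact ⟨(by fun_prop : ContDiff ℝ (⊤ : ℕ∞) fun a : Plane => a i).comp (hφ m).1,
      (hφ m).2.1.mono' (subset_closure.trans hsub), hsub.trans (hφ m).2.2⟩
  have hpd : ∀ m j x, pd j (fun y => φ m y i) x = fderiv ℝ (φ m) x (unitVec j) i := by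
    intro m j x
    have hd := ((hφ m).1.differentiable (by simp)).differentiableAt (x := x)
    have hp : HasFDerivAt (fun a : Plane => a i)
        (EuclideanSpace.proj i : Plane →L[ℝ] ℝ) (φ m x) :=
      (EuclideanSpace.proj i : Plane →L[ℝ] ℝ).hasFDerivAt
    exact congrArg (fun L : Plane →L[ℝ] ℝ => L (unitVec j)) (hp.comp x hd.hasFDerivAt).fderiv
  have l1 : Tendsto (fun m => eLpNorm (fun x => φ m x i - v x i) 1 (volume.restrict Ω))
      atTop (𝓝 0) :=
    conv (fun m => (hφ m).1.continuous.aestronglyMeasurable.sub hv2.1) hφv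
      fun m x => PiLp.norm_apply_le (φ m x - v x) i
  have l2 : ∀ j, Tendsto (fun m => eLpNorm
      (fun x => pd j (fun y => φ m y i) x - G x (unitVec j) i) 1 (volume.restrict Ω))
      atTop (𝓝 0) := fun j =>
    conv (fun m => ((hφ m).1.continuous_fderiv (by simp)).aestronglyMeasurable.sub hG.1) hφG
      fun m x => by
        rw [hpd]
        refine (PiLp.norm_apply_le ((fderiv ℝ (φ m) x - G x) (unitVec j)) i).trans ?_
        refine ((fderiv ℝ (φ m) x - G x).le_opNorm _).trans_eq ?_
        simp [unitVec]
  have hGi : ∀ j, Integrable (fun x => G x (unitVec j) i) (volume.restrict Ω) := fun j =>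
    (((EuclideanSpace.proj i : Plane →L[ℝ] ℝ).comp
      (ContinuousLinearMap.apply ℝ Plane (unitVec j))).integrable_comp (hG.integrable (by norm_num)))
  refine ⟨(hv.pwCont_apply i).memLp_top, fun j => (hv.pwCont_pd i j).memLp_top,
    fun m x => φ m x i, hφi, l1, fun j => (l2 j).congr fun m => ?_⟩
  refine eLpNorm_congr_ae ?_
  have : ∀ᵐ x ∂volume.restrict Ω, G x (unitVec j) i = pd j (fun y => v y i) x := by
    refine ae_restrict_of_openTri 𝒯 fun s hs => ?_
    obtain ⟨F, hF, hvF⟩ := hv s hs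
    exact ae_eq_pd_of_tendsto (isOpen_openTri s) (𝒯.interior_subset s hs) hφi
      ((by fun_prop : ContDiff ℝ (⊤ : ℕ∞) fun a : Plane => a i).comp hF)
      (fun x hx => by simp [hvF x hx]) (hv.pwCont_apply i).integrable (hGi j) l1 (l2 j)
  filter_upwards [this] with x hx
  rw [hx]

end

noncomputable section

/-! ### Polynomials in the plane -/

theorem totalDegree_pderiv_le {σ : Type*} (i : σ) (p : MvPolynomial σ ℝ) :
    (MvPolynomial.pderiv i p).totalDegree ≤ p.totalDegree - 1 := by
  classical
  conv_lhs => rw [p.as_sum, map_sum]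
  refine MvPolynomial.totalDegree_finsetSum_le fun a ha => ?_
  rw [MvPolynomial.pderiv_monomial]
  by_cases h0 : a i = 0
  · simp [h0]
  refine (MvPolynomial.totalDegree_monomial_le _ _).trans ?_
  have h1 := MvPolynomial.le_totalDegree ha
  have h2 : (a - Finsupp.single i 1) + Finsupp.single i 1 = a :=
    tsub_add_cancel_of_le (Finsupp.single_le_iff.2 (Nat.one_le_iff_ne_zero.2 h0))
  have h3 : (a - Finsupp.single i 1).degree + 1 = a.degree := by
    conv_rhs => rw [← h2]
    simp
  have h4 : a.degree ≤ p.totalDegree := h1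
  change (a - Finsupp.single i 1).degree ≤ _
  omega

theorem contDiff_evalAt (p : MvPolynomial (Fin 2) ℝ) : ContDiff ℝ (⊤ : ℕ∞) (evalAt p) := by
  induction p using MvPolynomial.induction_on with
  | C a =>
    have h : evalAt (MvPolynomial.C a) = fun _ => a := by ext x; simp [evalAt]
    exact h ▸ contDiff_const
  | add p q hp hq =>
    have h : evalAt (p + q) = fun x => evalAt p x + evalAt q x := by ext x; simp [evalAt]
    exact h ▸ hp.add hq
  | mul_X p i hp =>
    have h : evalAt (p * MvPolynomial.X i) = fun x => evalAt p x * x i := by ext x; simp [evalAt]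
    have hi : ContDiff ℝ (⊤ : ℕ∞) fun a : Plane => a i := by fun_prop
    exact h ▸ hp.mul hi

/-- The commutator of two derivations is a derivation, and this one kills every variable. -/
theorem pderiv_comm {σ : Type*} (i j : σ) (p : MvPolynomial σ ℝ) :
    MvPolynomial.pderiv i (MvPolynomial.pderiv j p) =
      MvPolynomial.pderiv j (MvPolynomial.pderiv i p) := by
  classical
  have h : ⁅MvPolynomial.pderiv (R := ℝ) i, MvPolynomial.pderiv (R := ℝ) j⁆ = 0 := by
    ext k : 1
    simp [Derivation.commutator_apply, MvPolynomial.pderiv_X, Pi.single_apply, apply_ite]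
  have := congrArg (fun D => D p) h
  rwa [Derivation.commutator_apply, Derivation.zero_apply, sub_eq_zero] at this

theorem pd_evalAt (p : MvPolynomial (Fin 2) ℝ) (j : Fin 2) :
    pd j (evalAt p) = evalAt (MvPolynomial.pderiv j p) := by
  have hd : ∀ (q : MvPolynomial (Fin 2) ℝ) x, DifferentiableAt ℝ (evalAt q) x := fun q x =>
    ((contDiff_evalAt q).differentiable (by simp)).differentiableAt
  induction p using MvPolynomial.induction_on with
  | C a =>
    have : evalAt (MvPolynomial.C a) = fun _ => a := by ext x; simp [evalAt]
    ext x
    rw [this]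
    simp [pd, evalAt]
  | add p q hp hq =>
    have : evalAt (p + q) = fun x => evalAt p x + evalAt q x := by ext x; simp [evalAt]
    ext x
    rw [this, pd, fderiv_fun_add (hd p x) (hd q x), FunLike.coe_add, Pi.add_apply]
    change pd j (evalAt p) x + pd j (evalAt q) x = _
    rw [hp, hq]
    simp [evalAt]
  | mul_X p i hp =>
    have : evalAt (p * MvPolynomial.X i) = fun x => evalAt p x * evalAt (MvPolynomial.X i) x := by
      ext x; simp [evalAt]
    have hX : ∀ x, pd j (evalAt (MvPolynomial.X i)) x =
        evalAt (MvPolynomial.pderiv j (MvPolynomial.X i)) x := by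
      intro x
      have h1 : evalAt (MvPolynomial.X i) = (EuclideanSpace.proj i : Plane →L[ℝ] ℝ) := by
        ext y; simp [evalAt]
      rw [h1, pd, ContinuousLinearMap.fderiv, MvPolynomial.pderiv_X]
      by_cases hij : i = j
      · subst hij; simp [evalAt, unitVec]
      · simp [evalAt, unitVec, hij]
    ext x
    rw [this, pd_mul (hd p x) (hd _ x), hp, hX, Derivation.leibniz]
    simp [evalAt]
    ring

theorem pd_congr {S : Set Plane} (hS : IsOpen S) {f g : Plane → ℝ} (h : ∀ x ∈ S, f x = g x)
    (j : Fin 2) : ∀ x ∈ S, pd j f x = pd j g x := by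
  intro x hx
  have he : f =ᶠ[𝓝 x] g := by
    filter_upwards [hS.mem_nhds hx] with y hy using h y hy
  rw [pd, pd, he.fderiv_eq]

theorem pd_of_eq_evalAt {S : Set Plane} (hS : IsOpen S) {f : Plane → ℝ}
    {p : MvPolynomial (Fin 2) ℝ} (h : ∀ x ∈ S, f x = evalAt p x) (j : Fin 2) :
    ∀ x ∈ S, pd j f x = evalAt (MvPolynomial.pderiv j p) x := by
  intro x hx
  rw [pd_congr hS h j x hx, pd_evalAt]

/-- The curl of a polynomial field. -/
def curlPoly (p : Fin 2 → MvPolynomial (Fin 2) ℝ) : MvPolynomial (Fin 2) ℝ :=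
  MvPolynomial.pderiv 0 (p 1) - MvPolynomial.pderiv 1 (p 0)

/-- The loss of one degree is why the inverse constant is taken for degree `k + 2` when the fields
have degree `k + 3`. -/
theorem totalDegree_curlPoly_le {p : Fin 2 → MvPolynomial (Fin 2) ℝ} {d : ℕ}
    (hp : ∀ i, (p i).totalDegree ≤ d + 1) : (curlPoly p).totalDegree ≤ d := by
  refine (MvPolynomial.totalDegree_sub _ _).trans (max_le ?_ ?_)
  · have := totalDegree_pderiv_le 0 (p 1)
    have := hp 1
    omega
  · have := totalDegree_pderiv_le 1 (p 0)
    have := hp 0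
    omega

section

variable {S : Set Plane} (hS : IsOpen S) {v : Plane → Plane} {p : Fin 2 → MvPolynomial (Fin 2) ℝ}
  (hv : ∀ i, ∀ x ∈ S, v x i = evalAt (p i) x)

include hS hv

theorem rot_eq_evalAt : ∀ x ∈ S, rot v x = evalAt (curlPoly p) x := by
  intro x hx
  rw [rot, pd_of_eq_evalAt hS (hv 1) 0 x hx, pd_of_eq_evalAt hS (hv 0) 1 x hx]
  simp [curlPoly, evalAt]

/-- The curl of the divergence of the symmetric gradient is half the Laplacian of the curl. -/
theorem rot_divTensor_symGrad (ν : ℝ) : ∀ x ∈ S,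
    rot (fun y => -(ν • divTensor (symGrad v) y)) x = -(ν / 2) *
      (evalAt (MvPolynomial.pderiv 0 (MvPolynomial.pderiv 0 (curlPoly p))) x +
        evalAt (MvPolynomial.pderiv 1 (MvPolynomial.pderiv 1 (curlPoly p))) x) := by
  have h1 : ∀ i j, ∀ x ∈ S, symGrad v x i j =
      evalAt (MvPolynomial.C (1 / 2) * (MvPolynomial.pderiv j (p i) + MvPolynomial.pderiv i (p j)))
        x := by
    intro i j x hx
    simp only [symGrad, Matrix.of_apply]
    rw [pd_of_eq_evalAt hS (hv i) j x hx, pd_of_eq_evalAt hS (hv j) i x hx]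
    simp [evalAt]
  have h2 : ∀ i, ∀ x ∈ S, (-(ν • divTensor (symGrad v) x)) i =
      evalAt (MvPolynomial.C (-ν) * ∑ j, MvPolynomial.pderiv j (MvPolynomial.C (1 / 2) *
        (MvPolynomial.pderiv j (p i) + MvPolynomial.pderiv i (p j)))) x := by
    intro i x hx
    simp only [divTensor, Fin.sum_univ_two, PiLp.neg_apply, PiLp.smul_apply, smul_eq_mul]
    rw [pd_of_eq_evalAt hS (h1 i 0) 0 x hx, pd_of_eq_evalAt hS (h1 i 1) 1 x hx]
    simp [evalAt]
  intro x hx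
  rw [rot, pd_of_eq_evalAt hS (h2 1) 0 x hx, pd_of_eq_evalAt hS (h2 0) 1 x hx]
  have comm : ∀ q : MvPolynomial (Fin 2) ℝ, MvPolynomial.pderiv 1 (MvPolynomial.pderiv 0 q) =
      MvPolynomial.pderiv 0 (MvPolynomial.pderiv 1 q) :=
    pderiv_comm 1 0
  simp [evalAt, curlPoly, Fin.sum_univ_two, comm]
  ring

end

/-! ### The inverse estimate -/

/-- For fixed `p` the inequality is closed in `γ`, so it survives at the infimum. A nonzero value of
`inverseConst` rules out the empty set of constants, whose `sInf` would be `0`. -/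
theorem polySobolevNorm_le_inverseConst {d m : ℕ} {s : Finset Plane}
    (h0 : inverseConst d m s ≠ 0) {p : MvPolynomial (Fin 2) ℝ} (hp : p.totalDegree ≤ d) :
    polySobolevNorm m (openTri s) p ≤
      inverseConst d m s / hE s ^ m * Real.sqrt (polyL2Sq (openTri s) p) := by
  set T : Set ℝ := {γ : ℝ | 0 < γ ∧ ∀ p : MvPolynomial (Fin 2) ℝ, p.totalDegree ≤ d →
    polySobolevNorm m (openTri s) p ≤ γ / hE s ^ m * Real.sqrt (polyL2Sq (openTri s) p)} with hT
  have hne : T.Nonempty := by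
    by_contra hemp
    rw [not_nonempty_iff_eq_empty] at hemp
    refine h0 ?_
    rw [inverseConst, ← hT, hemp, Real.sInf_empty]
  have hcl : IsClosed {γ : ℝ | polySobolevNorm m (openTri s) p ≤
      γ / hE s ^ m * Real.sqrt (polyL2Sq (openTri s) p)} :=
    isClosed_le continuous_const (by fun_prop)
  have hmem : inverseConst d m s ∈ closure T := csInf_mem_closure hne ⟨0, fun γ hγ => hγ.1.le⟩
  exact closure_minimal (fun γ hγ => hγ.2 p hp) hcl hmem

/-- The factor `2` comes from `(a + b)² ≤ 2a² + 2b²`; the pure second derivatives are two of the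
terms of the Sobolev norm. -/
theorem integral_laplacian_sq_le {d : ℕ} {s : Finset Plane} (h0 : inverseConst d 2 s ≠ 0)
    {p : MvPolynomial (Fin 2) ℝ} (hp : p.totalDegree ≤ d) :
    ∫ x in openTri s, (evalAt (MvPolynomial.pderiv 0 (MvPolynomial.pderiv 0 p)) x +
        evalAt (MvPolynomial.pderiv 1 (MvPolynomial.pderiv 1 p)) x) ^ 2 ≤
      2 * (inverseConst d 2 s ^ 2 / hE s ^ 4 * ∫ x in openTri s, (evalAt p x) ^ 2) := by
  have hnn : ∀ q, 0 ≤ polyL2Sq (openTri s) q := fun q => integral_nonneg fun x => sq_nonneg _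
  have h1 := polySobolevNorm_le_inverseConst h0 hp
  have h2 : polySobolevNorm 2 (openTri s) p ^ 2 ≤
      (inverseConst d 2 s / hE s ^ 2 * Real.sqrt (polyL2Sq (openTri s) p)) ^ 2 :=
    pow_le_pow_left₀ (Real.sqrt_nonneg _) h1 2
  rw [polySobolevNorm, Real.sq_sqrt (Finset.sum_nonneg fun _ _ => hnn _), mul_pow,
    Real.sq_sqrt (hnn _), div_pow, ← pow_mul] at h2
  have h3 : polyL2Sq (openTri s) (MvPolynomial.pderiv 0 (MvPolynomial.pderiv 0 p)) +
      polyL2Sq (openTri s) (MvPolynomial.pderiv 1 (MvPolynomial.pderiv 1 p)) ≤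
      ∑ α ∈ (Finset.range (2 + 1) ×ˢ Finset.range (2 + 1)).filter
        (fun α => α.1 + α.2 ≤ 2),
      polyL2Sq (openTri s)
        ((MvPolynomial.pderiv 0)^[α.1] ((MvPolynomial.pderiv 1)^[α.2] p)) := by
    refine le_of_eq_of_le ?_ (Finset.sum_le_sum_of_subset_of_nonneg
      (s := {((2 : ℕ), (0 : ℕ)), (0, 2)}) (by decide) fun _ _ _ => hnn _)
    rw [Finset.sum_pair (by decide)]
    rfl
  have int : ∀ f : Plane → ℝ, Continuous f → IntegrableOn f (openTri s) volume := fun f hf =>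
    (hf.continuousOn.integrableOn_compact (isCompact_hull s)).mono_set (openTri_subset_hull s)
  have hc : ∀ q, Continuous (evalAt q) := fun q => (contDiff_evalAt q).continuous
  calc _ ≤ ∫ x in openTri s, (2 * (evalAt (MvPolynomial.pderiv 0 (MvPolynomial.pderiv 0 p)) x) ^ 2 +
        2 * (evalAt (MvPolynomial.pderiv 1 (MvPolynomial.pderiv 1 p)) x) ^ 2) := by
        refine integral_mono (int _ (((hc _).add (hc _)).pow 2))
          (int _ ((continuous_const.mul ((hc _).pow 2)).add (continuous_const.mul ((hc _).pow 2))))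
          fun x => ?_
        dsimp only
        nlinarith [sq_nonneg (evalAt (MvPolynomial.pderiv 0 (MvPolynomial.pderiv 0 p)) x -
          evalAt (MvPolynomial.pderiv 1 (MvPolynomial.pderiv 1 p)) x)]
    _ = 2 * (polyL2Sq (openTri s) (MvPolynomial.pderiv 0 (MvPolynomial.pderiv 0 p)) +
      polyL2Sq (openTri s) (MvPolynomial.pderiv 1 (MvPolynomial.pderiv 1 p))) := by
        have hi : ∀ q, IntegrableOn (fun x => 2 * evalAt q x ^ 2) (openTri s) volume := fun q =>
          int _ (continuous_const.mul ((hc q).pow 2))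
        rw [integral_add (hi _) (hi _), integral_const_mul, integral_const_mul,
          polyL2Sq, polyL2Sq]
        ring
    _ ≤ _ := by
        have := h3.trans h2
        simp only [polyL2Sq] at this ⊢
        linarith

/-- The part of the stabilization that is not symmetric, on one element. -/
theorem element_stab_bound {k : ℕ} {s : Finset Plane} {v : Plane → Plane} {m M : Plane → ℝ}
    {ν δ : ℝ} (hν : 0 < ν) (hδ0 : 0 ≤ δ)
    (hδ : δ ≤ hE s ^ 4 / (ν * inverseConst (k + 2) 2 s ^ 2))
    (hv : IsPolyOn (k + 3) (openTri s) v) (hM : Continuous M) (hm : ∀ x ∈ openTri s, m x = M x) :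
    -(1 / 2) * (δ * ∫ x in openTri s, m x * m x) - ν / 4 * ∫ x in openTri s, (rot v x) ^ 2 ≤
      δ * ∫ x in openTri s, rot (fun y => -(ν • divTensor (symGrad v) y)) x * m x := by
  have hr : 0 ≤ ∫ x in openTri s, (rot v x) ^ 2 := integral_nonneg fun x => sq_nonneg _
  rcases hδ0.eq_or_lt with rfl | hδpos
  · simp only [zero_mul, mul_zero]
    nlinarith
  -- Division by zero gives `0`, so a vanishing constant would force `δ ≤ 0`. Hence finiteness of
  -- the inverse constant need not be proved separately. The diameter is treated likewise.
  have hγ : inverseConst (k + 2) 2 s ≠ 0 := by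
    intro h
    rw [h] at hδ
    simp at hδ
    linarith
  have hh : hE s ≠ 0 := by
    intro h
    rw [h] at hδ
    simp at hδ
    linarith
  choose p hp hvp using hv
  set c := curlPoly p with hc_def
  set D : Plane → ℝ := fun x => evalAt (MvPolynomial.pderiv 0 (MvPolynomial.pderiv 0 c)) x +
    evalAt (MvPolynomial.pderiv 1 (MvPolynomial.pderiv 1 c)) x with hD
  have hopen := isOpen_openTri s
  have hc : ∀ q, Continuous (evalAt q) := fun q => (contDiff_evalAt q).continuous
  have hDc : Continuous D := (hc _).add (hc _)
  have int : ∀ f : Plane → ℝ, Continuous f → IntegrableOn f (openTri s) volume := fun f hf =>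
    (hf.continuousOn.integrableOn_compact (isCompact_hull s)).mono_set (openTri_subset_hull s)
  have e1 : ∫ x in openTri s, rot (fun y => -(ν • divTensor (symGrad v) y)) x * m x =
      ∫ x in openTri s, (-(ν / 2) * D x) * M x :=
    setIntegral_congr_fun hopen.measurableSet fun x hx => by
      simp only [rot_divTensor_symGrad hopen hvp ν x hx, hm x hx, hD]
      rfl
  have e2 : ∫ x in openTri s, m x * m x = ∫ x in openTri s, M x ^ 2 :=
    setIntegral_congr_fun hopen.measurableSet fun x hx => by
      simp only [hm x hx]
      ring
  have e3 : ∫ x in openTri s, (rot v x) ^ 2 = ∫ x in openTri s, (evalAt c x) ^ 2 :=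
    setIntegral_congr_fun hopen.measurableSet fun x hx => by
      simp only [rot_eq_evalAt hopen hvp x hx, hc_def]
  have hbound := integral_laplacian_sq_le hγ (totalDegree_curlPoly_le (d := k + 2) hp)
  change ∫ x in openTri s, D x ^ 2 ≤ _ at hbound
  rw [← hc_def] at hbound
  -- Expand `(M - (ν/2) D)² ≥ 0`; the weights are chosen to use up exactly half of the curl square.
  have young : -(1 / 2) * (∫ x in openTri s, M x ^ 2) - ν ^ 2 / 8 * (∫ x in openTri s, D x ^ 2) ≤
      ∫ x in openTri s, (-(ν / 2) * D x) * M x := by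
    have h1 : IntegrableOn (fun x => -(1 / 2) * M x ^ 2) (openTri s) volume :=
      int _ (continuous_const.mul (hM.pow 2))
    have h2 : IntegrableOn (fun x => ν ^ 2 / 8 * D x ^ 2) (openTri s) volume :=
      int _ (continuous_const.mul (hDc.pow 2))
    rw [← integral_const_mul, ← integral_const_mul, ← integral_sub h1 h2]
    refine integral_mono (h1.sub h2) (int _ ((continuous_const.mul hDc).mul hM)) fun x => ?_
    dsimp only
    nlinarith [sq_nonneg (M x - ν / 2 * D x)]
  rw [e1, e2, e3]
  set R := ∫ x in openTri s, (evalAt c x) ^ 2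
  have hR : 0 ≤ R := integral_nonneg fun x => sq_nonneg _
  have hγ2 : 0 < inverseConst (k + 2) 2 s ^ 2 := by positivity
  have hh4 : 0 < hE s ^ 4 := by positivity
  rw [le_div_iff₀ (by positivity)] at hδ
  -- The constants multiply to `ν²/8 · 2 = ν · ν/4`, and `δ ν γ² / h⁴ ≤ 1` absorbs the remaining
  -- factor.
  have key : δ * (ν ^ 2 / 8 * ∫ x in openTri s, D x ^ 2) ≤ ν / 4 * R := by
    calc δ * (ν ^ 2 / 8 * ∫ x in openTri s, D x ^ 2)
        ≤ δ * (ν ^ 2 / 8 * (2 * (inverseConst (k + 2) 2 s ^ 2 / hE s ^ 4 * R))) := by gcongr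
      _ = ν / 4 * ((δ * (ν * inverseConst (k + 2) 2 s ^ 2)) / hE s ^ 4) * R := by ring
      _ ≤ ν / 4 * 1 * R := by
        gcongr
        rwa [div_le_one hh4]
      _ = ν / 4 * R := by ring
  have := mul_le_mul_of_nonneg_left young hδpos.le
  linarith

/-! ### Discretely divergence-free fields -/

variable {Ω : Set Plane}

theorem IsPolyOn.exists_contDiff {d : ℕ} {S : Set Plane} {v : Plane → Plane}
    (h : IsPolyOn d S v) :
    ∃ F : Plane → Plane, ContDiff ℝ (⊤ : ℕ∞) F ∧ ∀ x ∈ S, v x = F x := by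
  choose p _ hvp using h
  refine ⟨fun x => WithLp.toLp 2 fun i => evalAt (p i) x, ?_, fun x hx => ?_⟩
  · rw [contDiff_euclidean]
    exact fun i => contDiff_evalAt (p i)
  · ext i
    exact hvp i x hx

/-- Divergence-free fields of `[H¹₀(Ω)]²` that are polynomials of degree at most `k + 3` on each
element. -/
structure KernelField (𝒯 : Triangulation Ω) (k : ℕ) (v : Plane → Plane) : Prop where
  memH10 : MemH10 Ω v
  poly : ∀ s ∈ 𝒯.elems, IsPolyOn (k + 3) (openTri s) v
  div_eq_zero : divg v =ᵐ[volume.restrict Ω] 0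

theorem KernelField.pwSmooth {𝒯 : Triangulation Ω} {k : ℕ} {v : Plane → Plane}
    (h : KernelField 𝒯 k v) : PwSmooth 𝒯 v := fun s hs => (h.poly s hs).exists_contDiff

/-- The divergence itself belongs to `𝒬_h` up to a null set, so it may be used as the test function:
its square integrates to zero. -/
theorem FESpaces.divg_eq_zero {𝒯 : Triangulation Ω} {k : ℕ} (X : FESpaces Ω 𝒯 k)
    {v : Plane → Plane} (hv : v ∈ X.Z) : divg v =ᵐ[volume.restrict Ω] 0 := by
  obtain ⟨q, hq, hvq⟩ := X.div_mem v hv.1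
  have h0 := hv.2 q hq
  have h1 : ∫ x in Ω, q x ^ 2 = 0 := by
    rw [← h0, formB]
    refine integral_congr_ae ?_
    filter_upwards [hvq] with x hx
    rw [hx, sq]
  rw [integral_eq_zero_iff_of_nonneg (fun x => sq_nonneg _) (X.Q_L20 q hq).1.integrable_sq] at h1
  filter_upwards [hvq, h1] with x hx hx1
  rw [hx]
  simpa using hx1

theorem KernelField.of_mem_Z {𝒯 : Triangulation Ω} {k : ℕ} (X : FESpaces Ω 𝒯 k)
    {a b : Plane → Plane} (ha : a ∈ X.Z) (hb : b ∈ X.Z) (t : ℝ) : KernelField 𝒯 k (a + t • b) := by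
  have hmem : a + t • b ∈ X.V := X.V.add_mem ha.1 (X.V.smul_mem t hb.1)
  refine ⟨X.V_H10 _ hmem, X.V_poly _ hmem, ?_⟩
  filter_upwards [X.divg_eq_zero ha, X.divg_eq_zero hb, ae_mem_openTri 𝒯] with x hax hbx ⟨s, hs, hxs⟩
  have hd : ∀ v ∈ X.V, ∀ i, DifferentiableAt ℝ (fun y => v y i) x := by
    intro v hv i
    obtain ⟨p, _, hp⟩ := X.V_poly v hv s hs i
    refine (((contDiff_evalAt p).differentiable (by simp)).differentiableAt).congr_of_eventuallyEq ?_
    filter_upwards [(isOpen_openTri s).mem_nhds hxs] with y hy using hp y hy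
  have hpd : ∀ i, pd i (fun y => (a + t • b) y i) x =
      pd i (fun y => a y i) x + t * pd i (fun y => b y i) x := by
    intro i
    have h1 := (hd a ha.1 i).hasFDerivAt.add ((hd b hb.1 i).hasFDerivAt.const_smul t)
    exact congrArg (fun L : Plane →L[ℝ] ℝ => L (unitVec i)) h1.fderiv
  simp only [divg, Pi.zero_apply] at hax hbx ⊢
  simp only [hpd, Finset.sum_add_distrib, ← Finset.mul_sum, hax, hbx]
  simp

/-- For divergence-free fields the curl and the symmetric gradient have comparable norms. -/
theorem KernelField.integral_rot_sq {𝒯 : Triangulation Ω} {k : ℕ} {v : Plane → Plane}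
    (h : KernelField 𝒯 k v) : ∫ x in Ω, (rot v x) ^ 2 = 2 * formA Ω v v := by
  have hfin := isFiniteMeasure_restrict 𝒯
  have hcross := (h.memH10.h10Approx h.pwSmooth 0).integral_cross (h.memH10.h10Approx h.pwSmooth 1)
  have hp := h.pwSmooth.pwCont_pd
  have i1 : Integrable (fun x => rot v x ^ 2) (volume.restrict Ω) := by
    simp only [sq]
    exact (((hp 1 0).sub (hp 0 1)).mul ((hp 1 0).sub (hp 0 1))).integrable
  have i2 := (((hp 0 0).mul (hp 1 1)).sub ((hp 0 1).mul (hp 1 0))).integrable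
  -- When `div v = 0`, `2 ε(v) : ε(v)` and `(curl v)²` differ by a multiple of `det ∇v`, whose
  -- integral is zero by `hcross`.
  have hpt : ∀ᵐ x ∂volume.restrict Ω, 2 * ddot (symGrad v x) (symGrad v x) =
      rot v x ^ 2 + (-4) * (pd 0 (fun y => v y 0) x * pd 1 (fun y => v y 1) x -
        pd 1 (fun y => v y 0) x * pd 0 (fun y => v y 1) x) := by
    filter_upwards [h.div_eq_zero] with x hx
    simp only [divg, Fin.sum_univ_two, Pi.zero_apply] at hx
    simp only [ddot, symGrad, rot, Fin.sum_univ_two, Matrix.of_apply]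
    have : pd 1 (fun y => v y 1) x = -pd 0 (fun y => v y 0) x := by linarith
    rw [this]
    ring
  rw [formA, ← integral_const_mul, integral_congr_ae hpt, integral_add i1 (i2.const_mul _),
    integral_const_mul, hcross]
  ring

/-- The convective term vanishes on the diagonal. -/
theorem KernelField.formC_eq_zero {𝒯 : Triangulation Ω} {k : ℕ} {w v : Plane → Plane}
    (hw : KernelField 𝒯 k w) (hv : KernelField 𝒯 k v) : formC Ω w v v = 0 := by
  have hfin := isFiniteMeasure_restrict 𝒯
  -- These are the identities `∫ ∂_j (w_j v_i²) = 0`. Summed over `i` and `j` they give twice the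
  -- convective integral, plus `∫ (div w) |v|² = 0`.
  have tri := fun i j => (hv.memH10.h10Approx hv.pwSmooth i).integral_mul_mul
    (hv.memH10.h10Approx hv.pwSmooth i) (hw.memH10.h10Approx hw.pwSmooth j) j
  have hvp := hv.pwSmooth.pwCont_pd
  have hva := hv.pwSmooth.pwCont_apply
  have hwp := hw.pwSmooth.pwCont_pd
  have hwa := hw.pwSmooth.pwCont_apply
  have int : ∀ i j, Integrable (fun x => pd j (fun y => w y j) x * (v x i * v x i) +
      w x j * (pd j (fun y => v y i) x * v x i + v x i * pd j (fun y => v y i) x))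
      (volume.restrict Ω) := fun i j =>
    (((hwp j j).mul ((hva i).mul (hva i))).add ((hwa j).mul
      (((hvp i j).mul (hva i)).add ((hva i).mul (hvp i j))))).integrable
  have hpt : ∀ᵐ x ∂volume.restrict Ω, inner ℝ (convect v w x) (v x) = (1 / 2) * ∑ i, ∑ j,
      (pd j (fun y => w y j) x * (v x i * v x i) +
      w x j * (pd j (fun y => v y i) x * v x i + v x i * pd j (fun y => v y i) x)) := by
    filter_upwards [hw.div_eq_zero, ae_mem_openTri 𝒯] with x hx ⟨s, hs, hxs⟩
    obtain ⟨F, hF, hvF⟩ := hv.pwSmooth s hs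
    have hd : DifferentiableAt ℝ v x := by
      refine ((hF.differentiable (by simp)).differentiableAt).congr_of_eventuallyEq ?_
      filter_upwards [(isOpen_openTri s).mem_nhds hxs] with y hy using hvF y hy
    have hpd : ∀ i j, pd j (fun y => v y i) x = fderiv ℝ v x (unitVec j) i := fun i j =>
      congrArg (fun L : Plane →L[ℝ] ℝ => L (unitVec j))
        (((EuclideanSpace.proj i : Plane →L[ℝ] ℝ).hasFDerivAt).comp x hd.hasFDerivAt).fderiv
    have hwx : w x = w x 0 • unitVec 0 + w x 1 • unitVec 1 := by
      ext i
      fin_cases i <;> simp [unitVec]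
    have hconv : ∀ i, convect v w x i =
        w x 0 * pd 0 (fun y => v y i) x + w x 1 * pd 1 (fun y => v y i) x := by
      intro i
      rw [convect, hwx, map_add, map_smul, map_smul, hpd, hpd]
      simp [unitVec]
    simp only [divg, Fin.sum_univ_two, Pi.zero_apply] at hx
    have hx' : pd 1 (fun y => w y 1) x = -pd 0 (fun y => w y 0) x := by linarith
    rw [PiLp.inner_apply]
    simp only [Fin.sum_univ_two, hconv, hx', RCLike.inner_apply, conj_trivial]
    ring
  rw [formC, integral_congr_ae hpt, integral_const_mul,
    integral_finsetSum _ fun i _ => integrable_finsetSum _ fun j _ => int i j]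
  simp_rw [integral_finsetSum _ fun j _ => int _ j, tri]
  simp

end

noncomputable section

/-! ### Barycentric coordinates and the two sides of an edge -/

variable {Ω : Set Plane} (𝒯 : Triangulation Ω) {s : Finset Plane}

/-- The vertices of an element as an affine basis of the plane. -/
def Triangulation.basis (hs : s ∈ 𝒯.elems) : AffineBasis s ℝ Plane :=
  ⟨((↑) : s → Plane), 𝒯.indep s hs,
    ((𝒯.indep s hs).affineSpan_eq_top_iff_card_eq_finrank_add_one).2 (by
      rw [Fintype.card_coe, 𝒯.card_eq s hs, finrank_euclideanSpace_fin])⟩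

variable {𝒯}

theorem range_basis (hs : s ∈ 𝒯.elems) : range (𝒯.basis hs) = (s : Set Plane) :=
  Subtype.range_coe

theorem mem_hull_iff (hs : s ∈ 𝒯.elems) {x : Plane} :
    x ∈ hull s ↔ ∀ i, 0 ≤ (𝒯.basis hs).coord i x := by
  rw [hull, ← range_basis hs, AffineBasis.convexHull_eq_nonneg_coord, mem_ofPred_eq]

theorem mem_openTri_iff (hs : s ∈ 𝒯.elems) {x : Plane} :
    x ∈ openTri s ↔ ∀ i, 0 < (𝒯.basis hs).coord i x := by
  rw [openTri, hull, ← range_basis hs, AffineBasis.interior_convexHull, mem_ofPred_eq]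

theorem coord_add_smul (hs : s ∈ 𝒯.elems) (i : s) (x n : Plane) (h : ℝ) :
    (𝒯.basis hs).coord i (x + h • n) =
      (𝒯.basis hs).coord i x + h * ((𝒯.basis hs).coord i).linear n := by
  rw [add_comm, ← vadd_eq_add, AffineMap.map_vadd, map_smul, vadd_eq_add, smul_eq_mul, add_comm]

theorem coord_self (hs : s ∈ 𝒯.elems) (i : s) : (𝒯.basis hs).coord i i = 1 :=
  (𝒯.basis hs).coord_apply_eq i

theorem coord_of_ne (hs : s ∈ 𝒯.elems) (i : s) {p : Plane} (hp : p ∈ s) (hne : (i : Plane) ≠ p) :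
    (𝒯.basis hs).coord i p = 0 :=
  (𝒯.basis hs).coord_apply_ne (i := i) (j := ⟨p, hp⟩) fun h => hne (by rw [h])

/-- Nonzero orthogonal vectors span the plane; the determinant is nonzero by Lagrange's identity
`det(n,d)² + (n·d)² = |n|² |d|²`. -/
theorem linearMap_eq_zero_of_orthogonal {L : Plane →ₗ[ℝ] ℝ} {n d : Plane} (hn : n ≠ 0)
    (hd : d ≠ 0) (hnd : inner ℝ n d = 0) (h1 : L n = 0) (h2 : L d = 0) : L = 0 := by
  have hL : ∀ w, L w = w 0 * L (unitVec 0) + w 1 * L (unitVec 1) := by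
    intro w
    have hw : w = w 0 • unitVec 0 + w 1 • unitVec 1 := by
      ext i
      fin_cases i <;> simp [unitVec]
    conv_lhs => rw [hw]
    simp
  have hpos : ∀ w : Plane, w ≠ 0 → 0 < w 0 ^ 2 + w 1 ^ 2 := by
    intro w hw
    have := norm_pos_iff.2 hw
    have h := EuclideanSpace.real_norm_sq_eq w
    rw [Fin.sum_univ_two] at h
    rw [← h]
    positivity
  have hn' := hpos n hn
  have hd' := hpos d hd
  rw [hL] at h1 h2
  rw [PiLp.inner_apply] at hnd
  simp only [Fin.sum_univ_two, RCLike.inner_apply, conj_trivial] at hnd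
  have hdet : n 0 * d 1 - n 1 * d 0 ≠ 0 := by
    intro h
    have : (n 0 * d 1 - n 1 * d 0) ^ 2 + (d 0 * n 0 + d 1 * n 1) ^ 2 =
      (n 0 ^ 2 + n 1 ^ 2) * (d 0 ^ 2 + d 1 ^ 2) := by ring
    rw [h, hnd] at this
    have h' := mul_pos hn' hd'
    linarith
  have e0 : L (unitVec 0) = 0 := by
    have : (n 0 * d 1 - n 1 * d 0) * L (unitVec 0) = 0 := by linear_combination d 1 * h1 - n 1 * h2
    exact (mul_eq_zero.1 this).resolve_left hdet
  have e1 : L (unitVec 1) = 0 := by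
    have : (n 0 * d 1 - n 1 * d 0) * L (unitVec 1) = 0 := by linear_combination n 0 * h2 - d 0 * h1
    exact (mul_eq_zero.1 this).resolve_left hdet
  ext w
  rw [hL, e0, e1]
  simp

section Edge

variable {p q n : Plane} (hpq : p ≠ q)

include hpq

theorem exists_opposite_vertex (hs : s ∈ 𝒯.elems) (hp : p ∈ s) (hq : q ∈ s) :
    ∃ r : s, (r : Plane) ≠ p ∧ (r : Plane) ≠ q ∧ ∀ i : s, i = r ∨ (i : Plane) = p ∨ (i : Plane) = q := by
  classical
  have hsub : ({p, q} : Finset Plane) ⊆ s := by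
    intro x hx
    rcases Finset.mem_insert.1 hx with rfl | hx
    · exact hp
    · rwa [Finset.mem_singleton.1 hx]
  have hcard : (s \ {p, q}).card = 1 := by
    rw [Finset.card_sdiff_of_subset hsub, 𝒯.card_eq s hs, Finset.card_pair hpq]
  obtain ⟨r, hr⟩ := Finset.card_eq_one.1 hcard
  have hr' : r ∈ s \ {p, q} := by rw [hr]; simp
  simp only [Finset.mem_sdiff, Finset.mem_insert, Finset.mem_singleton, not_or] at hr'
  refine ⟨⟨r, hr'.1⟩, hr'.2.1, hr'.2.2, fun i => ?_⟩
  by_contra hcon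
  push Not at hcon
  have : (i : Plane) ∈ s \ {p, q} := by simp [hcon.2.1, hcon.2.2]
  rw [hr, Finset.mem_singleton] at this
  exact hcon.1 (Subtype.ext this)

theorem coord_openSegment (hs : s ∈ 𝒯.elems) (hp : p ∈ s) (hq : q ∈ s) {x : Plane}
    (hx : x ∈ openSegment ℝ p q) (i : s) :
    ((i : Plane) = p ∨ (i : Plane) = q → 0 < (𝒯.basis hs).coord i x) ∧
    ((i : Plane) ≠ p → (i : Plane) ≠ q → (𝒯.basis hs).coord i x = 0) := by
  rw [openSegment_eq_image_lineMap] at hx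
  obtain ⟨θ, ⟨h0, h1⟩, rfl⟩ := hx
  rw [AffineMap.apply_lineMap, AffineMap.lineMap_apply_ring]
  refine ⟨?_, fun h h' => by rw [coord_of_ne hs i hp h, coord_of_ne hs i hq h']; simp⟩
  rintro (h | h)
  · rw [coord_of_ne hs i hq (h ▸ hpq), ← h, coord_self]
    linarith
  · rw [coord_of_ne hs i hp (h ▸ hpq.symm), ← h, coord_self]
    linarith

/-- The barycentric coordinate of the opposite vertex is constant along the edge. If it were also
constant in the normal direction it would be constant, yet it is `0` at `p` and `1` at `r`. -/
theorem linear_normal_ne_zero (hs : s ∈ 𝒯.elems) (hp : p ∈ s) (hq : q ∈ s) (hn : ‖n‖ = 1)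
    (hnd : inner ℝ n (q - p) = 0) {r : s} (hrp : (r : Plane) ≠ p) (hrq : (r : Plane) ≠ q) :
    ((𝒯.basis hs).coord r).linear n ≠ 0 := by
  intro h
  have h2 : ((𝒯.basis hs).coord r).linear (q - p) = 0 := by
    rw [← vsub_eq_sub, AffineMap.linearMap_vsub, coord_of_ne hs r hp hrp, coord_of_ne hs r hq hrq]
    simp
  have hL := linearMap_eq_zero_of_orthogonal (norm_ne_zero_iff.1 (hn ▸ one_ne_zero))
    (sub_ne_zero.2 hpq.symm) hnd h h2
  have h3 : ((𝒯.basis hs).coord r).linear ((r : Plane) - p) = 1 := by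
    rw [← vsub_eq_sub, AffineMap.linearMap_vsub, coord_of_ne hs r hp hrp, coord_self]
    simp
  rw [hL] at h3
  simp at h3

/-- The opposite coordinate starts at `0` and increases along `n`; the other two are positive at `x`
and stay so for small `h`. -/
theorem eventually_mem_openTri (hs : s ∈ 𝒯.elems) (hp : p ∈ s) (hq : q ∈ s) {r : s}
    (hr : ∀ i : s, i = r ∨ (i : Plane) = p ∨ (i : Plane) = q)
    (hrp : (r : Plane) ≠ p) (hrq : (r : Plane) ≠ q)
    (hpos : 0 < ((𝒯.basis hs).coord r).linear n) {x : Plane} (hx : x ∈ openSegment ℝ p q) :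
    ∀ᶠ h in 𝓝[>] (0 : ℝ), x + h • n ∈ openTri s := by
  simp only [mem_openTri_iff hs, coord_add_smul]
  refine Filter.eventually_all.2 fun i => ?_
  obtain ⟨h1, h2⟩ := coord_openSegment hpq hs hp hq hx i
  rcases hr i with rfl | hi
  · filter_upwards [self_mem_nhdsWithin] with h hh
    rw [h2 hrp hrq, zero_add]
    exact mul_pos hh hpos
  · have hc : Tendsto (fun h : ℝ => (𝒯.basis hs).coord i x +
        h * ((𝒯.basis hs).coord i).linear n) (𝓝[>] 0) (𝓝 ((𝒯.basis hs).coord i x + 0 *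
        ((𝒯.basis hs).coord i).linear n)) := by
      refine Tendsto.mono_left (Continuous.tendsto ?_ 0) nhdsWithin_le_nhds
      fun_prop
    rw [zero_mul, add_zero] at hc
    exact hc.eventually (lt_mem_nhds (h1 hi))

/-- An interior edge has an element on each side. -/
theorem exists_elem_other_side (hΩ : IsOpen Ω) (hs : s ∈ 𝒯.elems) (hp : p ∈ s) (hq : q ∈ s)
    (hn : ‖n‖ = 1) (hnd : inner ℝ n (q - p) = 0) (hfr : ¬ segment ℝ p q ⊆ frontier Ω) :
    ∃ s' ∈ 𝒯.elems, ∀ x ∈ openSegment ℝ p q, ∀ᶠ h in 𝓝[>] (0 : ℝ), x + h • n ∈ openTri s' := by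
  obtain ⟨y, hy, hyfr⟩ := Set.not_subset.1 hfr
  have hyΩ : y ∈ Ω := by
    have h1 : y ∈ closure Ω := by
      rw [← 𝒯.cover]
      refine mem_biUnion (x := s) hs ?_
      exact (convex_convexHull ℝ (s : Set Plane)).segment_subset
        (subset_convexHull ℝ _ hp) (subset_convexHull ℝ _ hq) hy
    rw [hΩ.frontier_eq] at hyfr
    by_contra hcon
    exact hyfr ⟨h1, hcon⟩
  -- The point of the edge in `Ω` could be an endpoint; openness of `Ω` allows moving it into the
  -- open segment.
  rw [← closure_openSegment] at hy
  obtain ⟨x, hxΩ, hx⟩ := mem_closure_iff.1 hy Ω hΩ hyΩ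
  have hlim : Tendsto (fun h : ℝ => x + h • n) (𝓝[>] 0) (𝓝 x) := by
    have : Tendsto (fun h : ℝ => x + h • n) (𝓝 0) (𝓝 (x + (0 : ℝ) • n)) :=
      Continuous.tendsto (by fun_prop) 0
    rw [zero_smul, add_zero] at this
    exact this.mono_left nhdsWithin_le_nhds
  have hev : ∀ᶠ h in 𝓝[>] (0 : ℝ), ∃ r ∈ 𝒯.elems, x + h • n ∈ hull r := by
    filter_upwards [hlim.eventually (hΩ.mem_nhds hxΩ)] with h hh using subset_iUnion_hull 𝒯 hh
  -- Pigeonhole over finitely many elements: one of them contains `x + h n` for arbitrarily small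
  -- `h`.
  obtain ⟨r, hr, hfreq⟩ : ∃ r ∈ 𝒯.elems, ∃ᶠ h in 𝓝[>] (0 : ℝ), x + h • n ∈ hull r := by
    by_contra hcon
    push Not at hcon
    have h1 : ∀ᶠ h in 𝓝[>] (0 : ℝ), ∀ r ∈ 𝒯.elems, ¬ x + h • n ∈ hull r :=
      (Filter.eventually_all_finset _).2 hcon
    obtain ⟨h, ⟨r, hr, hmem⟩, hnot⟩ := (hev.and h1).exists
    exact hnot r hr hmem
  have hxr : x ∈ hull r := (isCompact_hull r).isClosed.mem_of_frequently_of_tendsto hfreq hlim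
  have hxs : x ∈ hull s := (convex_convexHull ℝ (s : Set Plane)).segment_subset
    (subset_convexHull ℝ _ hp) (subset_convexHull ℝ _ hq) (openSegment_subset_segment ℝ p q hx)
  -- By conformity `x` is in the hull of the common vertices of `s` and `r`. If an endpoint of the
  -- edge were not shared, its coordinate would vanish on that hull, but it is positive at `x`.
  have hvert : ∀ i : s, (i : Plane) = p ∨ (i : Plane) = q → (i : Plane) ∈ r := by
    intro i hi
    by_contra hir
    have hpos := (coord_openSegment hpq hs hp hq hx i).1 hi
    have hmem : x ∈ convexHull ℝ ((s : Set Plane) ∩ (r : Set Plane)) :=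
      𝒯.conforming s hs r hr ▸ ⟨hxs, hxr⟩
    have hsub : ((s : Set Plane) ∩ (r : Set Plane)) ⊆ (𝒯.basis hs).coord i ⁻¹' Iic 0 := by
      rintro z ⟨hzs, hzr⟩
      rw [mem_preimage, coord_of_ne hs i hzs fun h => hir (h ▸ hzr)]
      exact mem_Iic.2 le_rfl
    have := convexHull_min hsub ((convex_Iic (0 : ℝ)).affine_preimage _) hmem
    exact absurd (mem_Iic.1 this) (not_le.2 hpos)
  have hpr : p ∈ r := hvert ⟨p, hp⟩ (Or.inl rfl)
  have hqr : q ∈ r := hvert ⟨q, hq⟩ (Or.inr rfl)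
  obtain ⟨v, hvp, hvq, hv⟩ := exists_opposite_vertex hpq hr hpr hqr
  refine ⟨r, hr, fun z hz => eventually_mem_openTri hpq hr hpr hqr hv hvp hvq ?_ hz⟩
  obtain ⟨h, hmem, hh⟩ := (hfreq.and_eventually self_mem_nhdsWithin).exists
  have h1 := (mem_hull_iff hr).1 hmem v
  rw [coord_add_smul, (coord_openSegment hpq hr hpr hqr hx v).2 hvp hvq, zero_add] at h1
  exact lt_of_le_of_ne (nonneg_of_mul_nonneg_right h1 hh)
    (linear_normal_ne_zero hpq hr hpr hqr hn hnd hvp hvq).symm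

end Edge

/-! ### Jump terms -/

theorem jump_eq_sub {e : Finset Plane} (hfr : ¬ hull e ⊆ frontier Ω) {w F₁ F₂ : Plane → Plane}
    {S₁ S₂ : Set Plane} (hF₁ : Continuous F₁) (hF₂ : Continuous F₂) (h₁ : ∀ x ∈ S₁, w x = F₁ x)
    (h₂ : ∀ x ∈ S₂, w x = F₂ x) {x : Plane}
    (hx₁ : ∀ᶠ h in 𝓝[>] (0 : ℝ), x - h • 𝒯.normal e ∈ S₁)
    (hx₂ : ∀ᶠ h in 𝓝[>] (0 : ℝ), x + h • 𝒯.normal e ∈ S₂) : 𝒯.jump e w x = F₁ x - F₂ x := by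
  rw [Triangulation.jump, if_neg hfr]
  refine Tendsto.limUnder_eq ?_
  have hlim : Tendsto (fun h : ℝ => F₁ (x - h • 𝒯.normal e) - F₂ (x + h • 𝒯.normal e)) (𝓝[>] 0)
      (𝓝 (F₁ (x - (0 : ℝ) • 𝒯.normal e) - F₂ (x + (0 : ℝ) • 𝒯.normal e))) :=
    (Continuous.tendsto (by fun_prop) 0).mono_left nhdsWithin_le_nhds
  rw [zero_smul, sub_zero, add_zero] at hlim
  refine hlim.congr' ?_
  filter_upwards [hx₁, hx₂] with h hh₁ hh₂
  rw [h₁ _ hh₁, h₂ _ hh₂]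

/-- On an interior edge the limit defining the jump is, up to endpoints, the difference of the
smooth extensions from the two adjacent elements, hence continuous in `t`. -/
theorem contPiece_jump_sq (hΩ : IsOpen Ω) (hs : s ∈ 𝒯.elems) {e : Finset Plane}
    (he : e ∈ edges s) {I : Set ℝ} {w : ℝ → Plane → Plane}
    (hw : ∀ s ∈ 𝒯.elems, SmoothST I (openTri s) w) :
    ContPiece I fun t => ∫ x in hull e, ‖𝒯.jump e (w t) x‖ ^ 2
      ∂(Measure.hausdorffMeasure 1 : Measure Plane) := by
  by_cases hfr : hull e ⊆ frontier Ω
  · refine ⟨fun _ => 0, continuous_const, fun t _ => ?_⟩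
    simp [Triangulation.jump, hfr]
  obtain ⟨hes, hcard⟩ := Finset.mem_powersetCard.1 he
  obtain ⟨p, q, hpq, rfl⟩ := Finset.card_eq_two.1 hcard
  have hp : p ∈ s := hes (by simp)
  have hq : q ∈ s := hes (by simp)
  have hseg : hull {p, q} = segment ℝ p q := by
    rw [hull, Finset.coe_pair, convexHull_pair]
  have hn := 𝒯.normal_unit s hs _ he
  have hnd := 𝒯.normal_orth s hs _ he p (by simp) q (by simp)
  -- The first value in the jump is taken on the side of `-n`, so the neighbour is sought along the
  -- opposite normal.
  obtain ⟨s₁, hs₁, H₁⟩ := exists_elem_other_side hpq hΩ hs hp hq (n := -𝒯.normal {p, q})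
    (by rwa [norm_neg]) (by rw [inner_neg_left, hnd, neg_zero]) (hseg ▸ hfr)
  obtain ⟨s₂, hs₂, H₂⟩ := exists_elem_other_side hpq hΩ hs hp hq hn hnd (hseg ▸ hfr)
  obtain ⟨F₁, hF₁, hwF₁⟩ := hw s₁ hs₁
  obtain ⟨F₂, hF₂, hwF₂⟩ := hw s₂ hs₂
  set μ : Measure Plane := (Measure.hausdorffMeasure 1 : Measure Plane).restrict (hull {p, q})
    with hμ
  have hfin : IsFiniteMeasure μ := ⟨by
    rw [hμ, Measure.restrict_apply_univ, hseg, hausdorffMeasure_segment]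
    exact edist_lt_top p q⟩
  have hae : ∀ᵐ x ∂μ, x ∈ openSegment ℝ p q := by
    have hnull : ∀ z : Plane, ∀ᵐ x ∂μ, x ≠ z := by
      intro z
      have := Measure.nullSingletonClass_hausdorff Plane (d := 1) one_pos
      exact ae_restrict_of_ae (measure_eq_zero_iff_ae_notMem.1 (measure_singleton z))
    filter_upwards [ae_restrict_mem (isCompact_hull {p, q}).measurableSet, hnull p, hnull q]
      with x hx hxp hxq
    rw [hseg, ← insert_endpoints_openSegment] at hx
    rcases hx with hx | hx | hx
    · exact absurd hx hxp
    · exact absurd hx hxq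
    · exact hx
  refine ⟨fun t => ∫ x in hull {p, q}, ‖F₁ (t, x) - F₂ (t, x)‖ ^ 2 ∂μ,
    continuous_parametric_integral_of_continuous
      (f := fun t x => ‖F₁ (t, x) - F₂ (t, x)‖ ^ 2)
      (by
        have h₁ := hF₁.continuous
        have h₂ := hF₂.continuous
        change Continuous fun z : ℝ × Plane => ‖F₁ z - F₂ z‖ ^ 2
        fun_prop) (isCompact_hull _), fun t ht => ?_⟩
  dsimp only
  rw [Measure.restrict_restrict (isCompact_hull _).measurableSet, inter_self]
  refine integral_congr_ae ?_
  filter_upwards [hae] with x hx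
  have hc : Continuous fun x : Plane => (t, x) := by fun_prop
  rw [jump_eq_sub hfr (hF₁.continuous.comp hc) (hF₂.continuous.comp hc)
    (fun y hy => hwF₁ t ht y hy) (fun y hy => hwF₂ t ht y hy)
    (by simpa only [smul_neg, ← sub_eq_add_neg] using H₁ x hx) (H₂ x hx)]
  rfl

end

noncomputable section

variable {Ω : Set Plane} {𝒯 : Triangulation Ω}

/-! ### Integrals over the time grid -/

theorem intervalIntegrable_pieces {τ : ℝ} {n : ℕ} {f : ℝ → ℝ}
    (hf : ∀ j ≤ n, IntervalIntegrable f volume (j * τ) ((j + 1) * τ)) :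
    IntervalIntegrable f volume 0 ((n + 1) * τ) := by
  have := IntervalIntegrable.trans_iterate (f := f) (μ := volume) (a := fun j : ℕ => (j : ℝ) * τ)
    (n := n + 1) fun j hj => by simpa using hf j (by omega)
  simpa using this

theorem integral_eq_sum_pieces {τ : ℝ} {n : ℕ} {f : ℝ → ℝ}
    (hf : ∀ j ≤ n, IntervalIntegrable f volume (j * τ) ((j + 1) * τ)) :
    ∫ t in (0 : ℝ)..((n + 1) * τ), f t =
      ∑ j ∈ Finset.range (n + 1), ∫ t in (j * τ)..((j + 1) * τ), f t := by
  have := intervalIntegral.sum_integral_adjacent_intervals (f := f) (μ := volume)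
    (a := fun j : ℕ => (j : ℝ) * τ) (n := n + 1) fun j hj => by simpa using hf j (by omega)
  simpa using this.symm

theorem integral_mono_pieces {τ : ℝ} (hτ : 0 < τ) {n : ℕ} {f g : ℝ → ℝ}
    (hf : ∀ j ≤ n, IntervalIntegrable f volume (j * τ) ((j + 1) * τ))
    (hg : ∀ j ≤ n, IntervalIntegrable g volume (j * τ) ((j + 1) * τ))
    (hfg : ∀ j ≤ n, ∀ t ∈ Ioo (j * τ) ((j + 1) * τ), f t ≤ g t) :
    ∫ t in (0 : ℝ)..((n + 1) * τ), f t ≤ ∫ t in (0 : ℝ)..((n + 1) * τ), g t := by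
  rw [integral_eq_sum_pieces hf, integral_eq_sum_pieces hg]
  refine Finset.sum_le_sum fun j hj => ?_
  have hj' : j ≤ n := by simpa [Nat.lt_succ_iff] using hj
  exact intervalIntegral.integral_mono_on_of_le_Ioo (by nlinarith) (hf j hj') (hg j hj')
    (hfg j hj')

/-! ### Time derivatives and traces on one time interval -/

section Piece

variable {v : ℝ → Plane → Plane} {a b : Plane → Plane} {l r : ℝ}

theorem dt_of_affine (hv : ∀ t ∈ Ioo l r, v t = a + t • b) {t : ℝ} (ht : t ∈ Ioo l r) :
    dt v t = b := by
  ext1 x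
  have he : (fun s => v s x) =ᶠ[𝓝 t] fun s => a x + s • b x := by
    filter_upwards [isOpen_Ioo.mem_nhds ht] with s hs
    rw [hv s hs]
    rfl
  rw [dt, he.deriv_eq]
  simpa using (((hasDerivAt_id t).smul_const (b x)).const_add (a x)).deriv

theorem limUnder_right_of_affine (hlr : l < r) (hv : ∀ t ∈ Ioo l r, v t = a + t • b) (x : Plane) :
    limUnder (𝓝[>] l) (fun t => v t x) = (a + l • b) x := by
  refine Tendsto.limUnder_eq ?_
  have : Tendsto (fun t : ℝ => a x + t • b x) (𝓝[>] l) (𝓝 (a x + l • b x)) :=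
    (Continuous.tendsto (by fun_prop) l).mono_left nhdsWithin_le_nhds
  refine this.congr' ?_
  filter_upwards [Ioo_mem_nhdsGT hlr] with t ht
  rw [hv t ht]
  rfl

theorem limUnder_left_of_affine (hlr : l < r) (hv : ∀ t ∈ Ioo l r, v t = a + t • b) (x : Plane) :
    limUnder (𝓝[<] r) (fun t => v t x) = (a + r • b) x := by
  refine Tendsto.limUnder_eq ?_
  have : Tendsto (fun t : ℝ => a x + t • b x) (𝓝[<] r) (𝓝 (a x + r • b x)) :=
    (Continuous.tendsto (by fun_prop) r).mono_left nhdsWithin_le_nhds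
  refine this.congr' ?_
  filter_upwards [Ioo_mem_nhdsLT hlr] with t ht
  rw [hv t ht]
  rfl

theorem smoothST_of_affine (ha : PwSmooth 𝒯 a) (hb : PwSmooth 𝒯 b)
    (hv : ∀ t ∈ Ioo l r, v t = a + t • b) :
    ∀ s ∈ 𝒯.elems, SmoothST (Ioo l r) (openTri s) v := by
  intro s hs
  have ht : SmoothST (Ioo l r) (openTri s) fun t _ => t := ⟨Prod.fst, contDiff_fst, fun _ _ _ _ => rfl⟩
  refine ((ha.smoothST _ s hs).add (ht.comp₂ (hb.smoothST _ s hs) (φ := fun (c : ℝ) (y : Plane) => c • y)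
    (contDiff_fst.smul contDiff_snd))).congr fun t ht x _ => ?_
  rw [hv t ht]
  rfl

theorem smoothST_rot_material {w : ℝ → Plane → Plane} (hb : PwSmooth 𝒯 b)
    (hv : ∀ t ∈ Ioo l r, v t = a + t • b)
    (hvs : ∀ s ∈ 𝒯.elems, SmoothST (Ioo l r) (openTri s) v)
    (hws : ∀ s ∈ 𝒯.elems, SmoothST (Ioo l r) (openTri s) w) :
    ∀ s ∈ 𝒯.elems, SmoothST (Ioo l r) (openTri s) fun t x => rot (material w v t) x := by
  intro s hs
  have h1 : SmoothST (Ioo l r) (openTri s) (dt v) :=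
    (hb.smoothST _ s hs).congr fun t ht x _ => by rw [dt_of_affine hv ht]
  exact (h1.add ((hvs s hs).convect (isOpen_openTri s) (hws s hs))).rot (isOpen_openTri s)

end Piece

/-! ### The energy identity for the time derivative -/

theorem PwSmooth.pwCont {v : Plane → Plane} (h : PwSmooth 𝒯 v) : PwCont 𝒯 v := fun s hs => by
  obtain ⟨F, hF, hvF⟩ := h s hs
  exact ⟨F, hF.continuous, hvF⟩

theorem PwSmooth.add_smul {u v : Plane → Plane} (hu : PwSmooth 𝒯 u) (hv : PwSmooth 𝒯 v) (t : ℝ) :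
    PwSmooth 𝒯 (u + t • v) := fun s hs => by
  obtain ⟨F, hF, huF⟩ := hu s hs
  obtain ⟨G, hG, hvG⟩ := hv s hs
  exact ⟨fun x => F x + t • G x, hF.add (hG.const_smul t), fun x hx => by simp [huF x hx, hvG x hx]⟩

theorem PwSmooth.integrable_inner {u v : Plane → Plane} (hu : PwSmooth 𝒯 u) (hv : PwSmooth 𝒯 v) :
    Integrable (fun x => inner ℝ (u x) (v x)) (volume.restrict Ω) :=
  (hu.pwCont.comp₂ hv.pwCont (φ := fun y z => inner ℝ y z) (by
    change Continuous fun z : Plane × Plane => inner ℝ z.1 z.2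
    fun_prop)).integrable

theorem integral_norm_add_smul_sq {u v : Plane → Plane} (hu : PwSmooth 𝒯 u) (hv : PwSmooth 𝒯 v)
    (t : ℝ) : ∫ x in Ω, ‖(u + t • v) x‖ ^ 2 = l2 Ω u u + 2 * t * l2 Ω v u + t ^ 2 * l2 Ω v v := by
  have i1 := hu.integrable_inner hu
  have i2 := (hv.integrable_inner hu).const_mul (2 * t)
  have i3 := (hv.integrable_inner hv).const_mul (t ^ 2)
  rw [l2, l2, l2, ← integral_const_mul, ← integral_const_mul, ← integral_add i1 i2,
    ← integral_add (f := fun x => inner ℝ (u x) (u x) + 2 * t * inner ℝ (v x) (u x)) (i1.add i2) i3]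
  congr 1
  ext x
  rw [Pi.add_apply, Pi.smul_apply, ← real_inner_self_eq_norm_sq, inner_add_left, inner_add_right,
    inner_add_right, inner_smul_left, inner_smul_left, inner_smul_right, inner_smul_right,
    real_inner_comm (v x) (u x)]
  simp only [conj_trivial]
  ring

/-- Polarization. The squared jump produced here is the dissipation of the upwind coupling between
slabs. -/
theorem l2_sub_self {u v : Plane → Plane} (hu : PwSmooth 𝒯 u) (hv : PwSmooth 𝒯 v) :
    l2 Ω (fun x => u x - v x) u =
      (1 / 2) * ((∫ x in Ω, ‖u x - v x‖ ^ 2) + (∫ x in Ω, ‖u x‖ ^ 2) - ∫ x in Ω, ‖v x‖ ^ 2) := by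
  have e1 := integral_norm_add_smul_sq hu hv (-1)
  have e2 := integral_norm_add_smul_sq hu hv 0
  have e3 : ∫ x in Ω, ‖v x‖ ^ 2 = l2 Ω v v := by simp only [l2, real_inner_self_eq_norm_sq]
  have e4 : l2 Ω (fun x => u x - v x) u = l2 Ω u u - l2 Ω v u := by
    simp only [l2, inner_sub_left]
    exact integral_sub (hu.integrable_inner hu) (hv.integrable_inner hu)
  simp only [zero_smul, add_zero] at e2
  simp only [neg_one_smul, Pi.add_apply, Pi.neg_apply, ← sub_eq_add_neg] at e1
  rw [e1, e2, e3, e4]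
  ring

theorem integral_l2_dt {v : ℝ → Plane → Plane} {a b : Plane → Plane} {l r : ℝ} (hlr : l ≤ r)
    (ha : PwSmooth 𝒯 a) (hb : PwSmooth 𝒯 b) (hv : ∀ t ∈ Ioo l r, v t = a + t • b) :
    IntervalIntegrable (fun t => l2 Ω (dt v t) (v t)) volume l r ∧
    ∫ t in l..r, l2 Ω (dt v t) (v t) =
      (1 / 2) * ((∫ x in Ω, ‖(a + r • b) x‖ ^ 2) - ∫ x in Ω, ‖(a + l • b) x‖ ^ 2) := by
  have hpt : ∀ t ∈ Ioo l r, l2 Ω (dt v t) (v t) = l2 Ω b a + t * l2 Ω b b := by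
    intro t ht
    rw [dt_of_affine hv ht, hv t ht]
    simp only [l2, Pi.add_apply, Pi.smul_apply, inner_add_right, inner_smul_right]
    rw [integral_add (hb.integrable_inner ha) ((hb.integrable_inner hb).const_mul t),
      integral_const_mul]
  refine ⟨ContPiece.intervalIntegrable hlr ⟨fun t => l2 Ω b a + t * l2 Ω b b, by fun_prop, hpt⟩, ?_⟩
  have hlin : IntervalIntegrable (fun t => t * l2 Ω b b) volume l r :=
    Continuous.intervalIntegrable (by fun_prop) l r
  rw [intervalIntegral.integral_of_le hlr, integral_Ioc_eq_integral_Ioo,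
    setIntegral_congr_fun measurableSet_Ioo hpt, ← integral_Ioc_eq_integral_Ioo,
    ← intervalIntegral.integral_of_le hlr, intervalIntegral.integral_add (by simp) hlin,
    intervalIntegral.integral_mul_const, integral_id, intervalIntegral.integral_const,
    integral_norm_add_smul_sq ha hb, integral_norm_add_smul_sq ha hb, smul_eq_mul]
  ring

/-- `M` and `P` stand for the squared left and right traces and `J` for the squared jumps. At
interior nodes the traces cancel; at node `0` the full `P 0` minus its half leaves one half. -/
theorem time_energy_sum (n : ℕ) (M P J : ℕ → ℝ) :
    (∑ j ∈ Finset.range (n + 1), (1 / 2) * (M (j + 1) - P j)) +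
      ∑ j ∈ Finset.Icc 1 n, (1 / 2) * (J j + P j - M j) + P 0 =
    (1 / 2) * (M (n + 1) + ∑ j ∈ Finset.Icc 1 n, J j + P 0) := by
  induction n with
  | zero => simp; ring
  | succ n ih =>
    rw [Finset.sum_range_succ, Finset.sum_Icc_succ_top (by omega), Finset.sum_Icc_succ_top (by omega)]
    linarith

theorem time_energy {k : ℕ} (X : FESpaces Ω 𝒯 k) {τ : ℝ} (hτ : 0 < τ) {N n : ℕ} (hn : n ≤ N)
    {v : ℝ → Plane → Plane} (hv : v ∈ P1Time τ N X.Z) :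
    (∫ t in (0 : ℝ)..((n + 1) * τ), l2 Ω (dt v t) (v t))
      + ∑ j ∈ Finset.Icc 1 n, l2 Ω (timeJump τ v j) (tracePlus τ v j)
      + l2 Ω (tracePlus τ v 0) (tracePlus τ v 0) =
    (1 / 2) * ((∫ x in Ω, ‖traceMinus τ v (n + 1) x‖ ^ 2)
      + ∑ j ∈ Finset.Icc 1 n, (∫ x in Ω, ‖timeJump τ v j x‖ ^ 2)
      + ∫ x in Ω, ‖tracePlus τ v 0 x‖ ^ 2) := by
  have hps : ∀ u ∈ X.Z, PwSmooth 𝒯 u := fun u hu s hs => (X.V_poly u hu.1 s hs).exists_contDiff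
  have hlt : ∀ j : ℕ, (j : ℝ) * τ < ((j : ℝ) + 1) * τ := fun j => by nlinarith
  choose! a ha b hb hab using hv
  have hplus : ∀ j ≤ N, tracePlus τ v j = a j + ((j : ℝ) * τ) • b j := fun j hj =>
    funext fun x => limUnder_right_of_affine (hlt j) (hab j hj) x
  have hminus : ∀ j ≤ N, traceMinus τ v (j + 1) = a j + (((j : ℝ) + 1) * τ) • b j := fun j hj =>
    funext fun x => by
      rw [traceMinus, Nat.cast_succ]
      exact limUnder_left_of_affine (hlt j) (hab j hj) x
  have hI := fun j (hj : j ≤ N) =>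
    integral_l2_dt (hlt j).le (hps _ (ha j hj)) (hps _ (hb j hj)) (hab j hj)
  have hplusS : ∀ j ≤ N, PwSmooth 𝒯 (tracePlus τ v j) := fun j hj => by
    rw [hplus j hj]
    exact (hps _ (ha j hj)).add_smul (hps _ (hb j hj)) _
  have hminusS : ∀ j ≤ N, PwSmooth 𝒯 (traceMinus τ v (j + 1)) := fun j hj => by
    rw [hminus j hj]
    exact (hps _ (ha j hj)).add_smul (hps _ (hb j hj)) _
  rw [integral_eq_sum_pieces fun j hj => (hI j (hj.trans hn)).1]
  have e0 : l2 Ω (tracePlus τ v 0) (tracePlus τ v 0) = ∫ x in Ω, ‖tracePlus τ v 0 x‖ ^ 2 := by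
    simp only [l2, real_inner_self_eq_norm_sq]
  rw [e0, ← time_energy_sum n (fun j => ∫ x in Ω, ‖traceMinus τ v j x‖ ^ 2)
    (fun j => ∫ x in Ω, ‖tracePlus τ v j x‖ ^ 2) (fun j => ∫ x in Ω, ‖timeJump τ v j x‖ ^ 2)]
  congr 2
  · refine Finset.sum_congr rfl fun j hj => ?_
    have hj' : j ≤ N := by
      have := Finset.mem_range.1 hj
      omega
    rw [(hI j hj').2, hplus j hj', hminus j hj']
  · refine Finset.sum_congr rfl fun j hj => ?_
    obtain ⟨h1, h2⟩ := Finset.mem_Icc.1 hj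
    -- With `j = i + 1`, the left trace at node `j` comes from slab `i` and the right trace from
    -- slab `i + 1`.
    obtain ⟨i, rfl⟩ := Nat.exists_eq_add_of_le' h1
    exact l2_sub_self (hplusS _ (by omega)) (hminusS i (by omega))

/-! ### Coercivity at a fixed time -/

theorem jumpIntegral_self (s : Finset Plane) (f : Plane → Plane) :
    𝒯.jumpIntegral s f f = ∑ e ∈ edges s, ∫ x in hull e, ‖𝒯.jump e f x‖ ^ 2
      ∂(Measure.hausdorffMeasure 1 : Measure Plane) := by
  simp only [Triangulation.jumpIntegral, real_inner_self_eq_norm_sq]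

/-- The loss from `stabL` is half of `stabC` plus `ν/4 · ‖curl V‖² = ν/2 · formA`, while the jump
term is untouched and nonnegative. -/
theorem kStab_lower_bound {k : ℕ} {δ : Finset Plane → ℝ} {ν : ℝ} (hν : 0 < ν)
    (hδ0 : ∀ s ∈ 𝒯.elems, 0 ≤ δ s)
    (hδ : ∀ s ∈ 𝒯.elems, δ s ≤ hE s ^ 4 / (ν * inverseConst (k + 2) 2 s ^ 2))
    {W V : ℝ → Plane → Plane} {t : ℝ} (hW : KernelField 𝒯 k (W t)) (hV : KernelField 𝒯 k (V t))
    (hm : PwCont 𝒯 fun x => rot (material W V t) x) :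
    (1 / 2) * (ν * formA Ω (V t) (V t) + stabC 𝒯 δ W W V V t + stabJ 𝒯 W W V V t) ≤
      kStab 𝒯 δ ν W W V V t := by
  have hJ : 0 ≤ stabJ 𝒯 W W V V t := by
    refine Finset.sum_nonneg fun s _ => mul_nonneg (by positivity) ?_
    rw [jumpIntegral_self]
    exact Finset.sum_nonneg fun e _ => integral_nonneg fun x => sq_nonneg _
  have hrot := hV.integral_rot_sq
  have hrotC : PwCont 𝒯 fun x => rot (V t) x ^ 2 := by
    have hp := hV.pwSmooth.pwCont_pd
    simp only [sq]
    exact ((hp 1 0).sub (hp 0 1)).mul ((hp 1 0).sub (hp 0 1))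
  rw [integral_eq_sum_openTri hrotC] at hrot
  have hL : -(1 / 2) * stabC 𝒯 δ W W V V t -
      ν / 4 * ∑ s ∈ 𝒯.elems, ∫ x in openTri s, rot (V t) x ^ 2 ≤ stabL 𝒯 δ ν W V V t := by
    rw [stabC, Finset.mul_sum, Finset.mul_sum, ← Finset.sum_sub_distrib]
    refine Finset.sum_le_sum fun s hs => ?_
    obtain ⟨M, hM, hmM⟩ := hm s hs
    exact element_stab_bound hν (hδ0 s hs) (hδ s hs) (hV.poly s hs) hM hmM
  rw [kStab, hW.formC_eq_zero hV]
  rw [hrot] at hL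
  linarith

end

end VorticitySUPG

/-! ### Assembly over the time grid -/

theorem mainTheorem3 {Ω : Set Plane} (hΩ : IsOpen Ω)
    (𝒯 : Triangulation Ω) (cM1 : ℝ) (hM1 : 𝒯.ShapeRegular cM1)
    (k : ℕ) (X : FESpaces Ω 𝒯 k)
    (ν : ℝ) (hν : 0 < ν) (τ : ℝ) (hτ : 0 < τ) (N : ℕ)
    (δ : Finset Plane → ℝ)
    (hδ_nonneg : ∀ E ∈ 𝒯.elems, 0 ≤ δ E)
    (hδ : ∀ E ∈ 𝒯.elems, δ E ≤ hE E ^ 4 / (ν * inverseConst (k + 2) 2 E ^ 2)) :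
    ∀ W ∈ P1Time τ N X.Z, ∀ V ∈ P1Time τ N X.Z, ∀ n ≤ N,
      aStab 𝒯 δ ν τ n W W V V ≥ (1 / 2) * normSqW 𝒯 δ ν τ n W V := by
  intro W hW V hV n hn
  have htime := time_energy X hτ hn hV
  have hps : ∀ u ∈ X.Z, PwSmooth 𝒯 u := fun u hu s hs => (X.V_poly u hu.1 s hs).exists_contDiff
  have hle : ∀ j : ℕ, (j : ℝ) * τ ≤ ((j : ℝ) + 1) * τ := fun j => by nlinarith
  choose! a ha b hb hab using hV
  choose! c hc d hd hcd using hW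
  have hN : ∀ j ≤ n, j ≤ N := fun j hj => hj.trans hn
  have hVs := fun j (hj : j ≤ n) => smoothST_of_affine (hps _ (ha j (hN j hj)))
    (hps _ (hb j (hN j hj))) (hab j (hN j hj))
  have hWs := fun j (hj : j ≤ n) => smoothST_of_affine (hps _ (hc j (hN j hj)))
    (hps _ (hd j (hN j hj))) (hcd j (hN j hj))
  have hRs := fun j (hj : j ≤ n) => smoothST_rot_material (hps _ (hb j (hN j hj)))
    (hab j (hN j hj)) (hVs j hj) (hWs j hj)
  have hVk : ∀ j ≤ n, ∀ t ∈ Ioo (j * τ) ((j + 1) * τ), KernelField 𝒯 k (V t) := fun j hj t ht =>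
    hab j (hN j hj) t ht ▸ KernelField.of_mem_Z X (ha j (hN j hj)) (hb j (hN j hj)) t
  have hWk : ∀ j ≤ n, ∀ t ∈ Ioo (j * τ) ((j + 1) * τ), KernelField 𝒯 k (W t) := fun j hj t ht =>
    hcd j (hN j hj) t ht ▸ KernelField.of_mem_Z X (hc j (hN j hj)) (hd j (hN j hj)) t
  have cA : ∀ j ≤ n, ContPiece (Ioo (j * τ) ((j + 1) * τ)) fun t => formA Ω (V t) (V t) :=
    fun j hj => contPiece_integral_of_smoothST fun s hs =>
      (hVs j hj s hs).ddot_symGrad (isOpen_openTri s)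
  have cC : ∀ s ∈ 𝒯.elems, ∀ j ≤ n, ContPiece (Ioo (j * τ) ((j + 1) * τ)) fun t =>
      ∫ x in openTri s, rot (material W V t) x * rot (material W V t) x :=
    fun s hs j hj => ((hRs j hj s hs).mul (hRs j hj s hs)).contPiece_integral
  have cL : ∀ j ≤ n, ContPiece (Ioo (j * τ) ((j + 1) * τ)) (stabL 𝒯 δ ν W V V) :=
    fun j hj => ContPiece.sum _ fun s hs => ContPiece.const_mul (SmoothST.contPiece_integral
      (SmoothST.mul ((((hVs j hj s hs).divTensor (isOpen_openTri s)).comp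
        (φ := fun y : Plane => -(ν • y)) (by fun_prop)).rot (isOpen_openTri s))
        (hRs j hj s hs))) _
  have cJ : ∀ s ∈ 𝒯.elems, ∀ j ≤ n, ContPiece (Ioo (j * τ) ((j + 1) * τ)) fun t =>
      ∑ e ∈ edges s, ∫ x in hull e, ‖𝒯.jump e (convect (V t) (W t)) x‖ ^ 2
        ∂(Measure.hausdorffMeasure 1 : Measure Plane) :=
    fun s hs j hj => ContPiece.sum _ fun e he => contPiece_jump_sq hΩ hs he fun r hr =>
      (hVs j hj r hr).convect (isOpen_openTri r) (hWs j hj r hr)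
  have cSC : ∀ j ≤ n, ContPiece (Ioo (j * τ) ((j + 1) * τ)) (stabC 𝒯 δ W W V V) :=
    fun j hj => ContPiece.sum _ fun s hs => (cC s hs j hj).const_mul _
  have hSJ : stabJ 𝒯 W W V V = fun t => ∑ s ∈ 𝒯.elems, hE s ^ 2 / 2 *
      ∑ e ∈ edges s, ∫ x in hull e, ‖𝒯.jump e (convect (V t) (W t)) x‖ ^ 2
        ∂(Measure.hausdorffMeasure 1 : Measure Plane) := by
    ext t
    simp only [stabJ, jumpIntegral_self]
  have cSJ : ∀ j ≤ n, ContPiece (Ioo (j * τ) ((j + 1) * τ)) (stabJ 𝒯 W W V V) :=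
    fun j hj => hSJ ▸ ContPiece.sum _ fun s hs => (cJ s hs j hj).const_mul _
  -- The convective term is identically zero on each slab, so its integrability needs no separate
  -- argument.
  have cK : ∀ j ≤ n, ContPiece (Ioo (j * τ) ((j + 1) * τ)) (kStab 𝒯 δ ν W W V V) :=
    fun j hj => ((((((cA j hj).const_mul ν).add (cSC j hj)).add (cL j hj)).add (cSJ j hj))).congr
      fun t ht => by
        rw [kStab, (hWk j hj t ht).formC_eq_zero (hVk j hj t ht), add_zero]
  have ii : ∀ {f : ℝ → ℝ}, (∀ j ≤ n, ContPiece (Ioo (j * τ) ((j + 1) * τ)) f) →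
      IntervalIntegrable f volume 0 ((n + 1) * τ) := fun hf =>
    intervalIntegrable_pieces fun j hj => (hf j hj).intervalIntegrable (hle j)
  have hK : ∫ t in (0 : ℝ)..((n + 1) * τ), (1 / 2) * (ν * formA Ω (V t) (V t) +
      stabC 𝒯 δ W W V V t + stabJ 𝒯 W W V V t) ≤
      ∫ t in (0 : ℝ)..((n + 1) * τ), kStab 𝒯 δ ν W W V V t :=
    integral_mono_pieces hτ (fun j hj => ((((((cA j hj).const_mul ν).add (cSC j hj)).add
      (cSJ j hj))).const_mul _).intervalIntegrable (hle j))
      (fun j hj => (cK j hj).intervalIntegrable (hle j)) fun j hj t ht =>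
        kStab_lower_bound hν hδ_nonneg hδ (hWk j hj t ht) (hVk j hj t ht)
          (pwCont_of_smoothST (hRs j hj) ht)
  have iA : IntervalIntegrable (fun t => ν * formA Ω (V t) (V t)) volume 0 ((n + 1) * τ) :=
    (ii cA).const_mul ν
  rw [intervalIntegral.integral_const_mul, intervalIntegral.integral_add (iA.add (ii cSC)) (ii cSJ),
    intervalIntegral.integral_add iA (ii cSC), intervalIntegral.integral_const_mul] at hK
  have eC : ∫ t in (0 : ℝ)..((n + 1) * τ), stabC 𝒯 δ W W V V t =
      ∑ s ∈ 𝒯.elems, δ s * (∫ t in (0 : ℝ)..((n + 1) * τ), ∫ x in openTri s,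
        (rot (material W V t) x) ^ 2) := by
    simp only [stabC, sq]
    rw [intervalIntegral.integral_finsetSum fun s hs => (ii (cC s hs)).const_mul _]
    simp only [intervalIntegral.integral_const_mul]
  have eJ : ∫ t in (0 : ℝ)..((n + 1) * τ), stabJ 𝒯 W W V V t =
      ∑ s ∈ 𝒯.elems, hE s ^ 2 / 2 * (∫ t in (0 : ℝ)..((n + 1) * τ), ∑ e ∈ edges s,
        ∫ x in hull e, ‖𝒯.jump e (convect (V t) (W t)) x‖ ^ 2
          ∂(Measure.hausdorffMeasure 1 : Measure Plane)) := by
    rw [hSJ, intervalIntegral.integral_finsetSum fun s hs => (ii (cJ s hs)).const_mul _]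
    simp only [intervalIntegral.integral_const_mul]
  -- The time part is available with its full coefficient; nonnegativity allows half of it to be
  -- discarded.
  have hnn : 0 ≤ (∫ x in Ω, ‖traceMinus τ V (n + 1) x‖ ^ 2)
      + ∑ j ∈ Finset.Icc 1 n, (∫ x in Ω, ‖timeJump τ V j x‖ ^ 2)
      + ∫ x in Ω, ‖tracePlus τ V 0 x‖ ^ 2 := by
    have h0 : ∀ f : Plane → Plane, 0 ≤ ∫ x in Ω, ‖f x‖ ^ 2 :=
      fun f => integral_nonneg fun x => sq_nonneg _
    exact add_nonneg (add_nonneg (h0 _) (Finset.sum_nonneg fun j _ => h0 _)) (h0 _)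
  rw [eC, eJ] at hK
  simp only [formA] at hK
  rw [ge_iff_le, aStab, normSqW, htime]
  linarith
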